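/- Let $\tilde Q$ be a smooth finite-dimensional manifold (Hausdorff, second countable) with a free and proper smooth left action of a Lie group $F$, with Lie algebra $\mathfrak f$ and $k=\dim\mathfrak f$, and let $F$ act on $T^*\tilde Q$ by the cotangent lift. For $\nu\in\mathfrak f$ denote by $\nu_{\tilde Q}$, $\nu_{T^*\tilde Q}$ its infinitesimal generators. Let $\tau:T^*\tilde Q\to\tilde Q$ be the projection, $\Theta$ the canonical $1$-form, $\Omega_{\tilde Q}=-d\Theta$ the canonical $2$-form on $T^*\tilde Q$, and $\tilde J:T^*\tilde Q\to\mathfrak f^*$, $\langle\tilde J(\alpha),\nu\rangle=\Theta_\alpha(\nu_{T^*\tilde Q}(\alpha))$, the canonical momentum map. Let $\tilde A:T\tilde Q\to\mathfrak f$ be a principal connection. Let $\eta_1,\dots,\eta_k:\tilde Q\to\mathfrak f$ be smooth functions such that $\eta_1(x),\dots,\eta_k(x)$ is a basis of $\mathfrak f$ for every $x\in\tilde Q$ and such that the functions $\tilde J_i(\alpha_x)=\langle\tilde J(\alpha_x),\eta_i(x)\rangle$, $\alpha_x\in T_x^*\tilde Q$, are $F$-invariant. Let $\mu^1,\dots,\mu^k:\tilde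 Q\to\mathfrak f^*$ be the dual basis, $\langle\mu^i(x),\eta_j(x)\rangle=\delta_{ij}$, and let $\tilde Y^1,\dots,\tilde Y^k$ be the $1$-forms on $\tilde Q$ with $\tilde Y^i((\eta_j)_{\tilde Q})=\delta_{ij}$ and $\tilde Y^i|_{\ker\tilde A}=0$, so that $\tilde A=\sum_i\tilde Y^i\otimes\eta_i$. For an $\mathfrak f^*$-valued function $m$ on $\tilde Q$ put $\tilde J^{-1}(m)=\{\alpha_x\in T^*\tilde Q:\tilde J(\alpha_x)=m(x)\}$. Let $c_1,\dots,c_k\in\mathbb R$ and $\mu=\sum_i c_i\mu^i$. Then the map $$\mathrm{Shift}_\mu:T^*\tilde Q\to T^*\tilde Q,\qquad \alpha_x\mapsto\alpha_x-\langle\mu(x),\tilde A_x\rangle,$$ is a diffeomorphism, and: (i) $\mathrm{Shift}_\mu^*\,\Omega_{\tilde Q}=\Omega_{\tilde Q}+\tau^*\bigl(\sum_i c_i\,d\tilde Y^i\bigr)$. (ii) $\tilde J^{-1}(\mu)$ and $\tilde J^{-1}(0)$ are $F$-invariant embedded submanifolds of $T^*\tilde Q$, and $\tilde J^{-1}(\mu)/F$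 and $\tilde J^{-1}(0)/F$ are (Hausdorff, second countable) smooth manifolds for which the orbit projections $\rho_\mu$, $\rho_0$ are submersions. $\mathrm{Shift}_\mu$ restricts to an $F$-equivariant diffeomorphism $\mathrm{shift}_\mu:\tilde J^{-1}(\mu)\to\tilde J^{-1}(0)$, and there is a diffeomorphism $\overline{\mathrm{shift}}_\mu:\tilde J^{-1}(\mu)/F\to\tilde J^{-1}(0)/F$ with $\overline{\mathrm{shift}}_\mu\circ\rho_\mu=\rho_0\circ\mathrm{shift}_\mu$. -/

import Mathlib

open scoped Manifold ContDiff Topology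
open Bundle

noncomputable section

/-! ## Differential forms on boundaryless manifolds -/

section Forms

variable {E : Type*} [NormedAddCommGroup E] [NormedSpace ℝ E]
  {H : Type*} [TopologicalSpace H] (I : ModelWithCorners ℝ E H)
  {M : Type*} [TopologicalSpace M] [ChartedSpace H M]
  {E' : Type*} [NormedAddCommGroup E'] [NormedSpace ℝ E']
  {H' : Type*} [TopologicalSpace H'] (I' : ModelWithCorners ℝ E' H')
  {M' : Type*} [TopologicalSpace M'] [ChartedSpace H' M']

variable (M) in
/-- (Not necessarily smooth) differential `n`-forms on `M`. -/
abbrev DForm (n : ℕ) : Type _ := ∀ x : M, TangentSpace I x [⋀^Fin n]→L[ℝ] ℝ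

variable {I} in
/-- A field of covectors, seen as a differential `1`-form. -/
def oneForm (θ : ∀ x : M, TangentSpace I x →L[ℝ] ℝ) : DForm I M 1 :=
  fun x => ContinuousAlternatingMap.ofSubsingleton ℝ (TangentSpace I x) ℝ (0 : Fin 1) (θ x)

variable {I I'} in
/-- The pull-back `f^* θ` of a form. -/
def pullbackForm (f : M → M') {n : ℕ} (θ : DForm I' M' n) : DForm I M n :=
  fun x => (θ (f x)).compContinuousLinearMap (mfderiv I I' f x)

variable {I} in
/-- The exterior derivative of a form on a boundaryless manifold: at `x`, write the form in the
chart `φ` at `x` (that is, pull it back by `φ⁻¹`), take the exterior derivative in the model vector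
space, and pull the result back by `φ`. -/
def dForm {n : ℕ} (θ : DForm I M n) : DForm I M (n + 1) := fun x =>
  (extDeriv (fun y : E => ((θ ((extChartAt I x).symm y)).compContinuousLinearMap
      (mfderiv 𝓘(ℝ, E) I (extChartAt I x).symm y) : E [⋀^Fin n]→L[ℝ] ℝ))
    (extChartAt I x x)).compContinuousLinearMap (mfderiv I 𝓘(ℝ, E) (extChartAt I x) x)

end Forms

/-! ## Embedded submanifolds and quotient manifolds -/

section Structures

variable {E : Type*} [NormedAddCommGroup E] [NormedSpace ℝ E]
  {H : Type*} [TopologicalSpace H] (I : ModelWithCorners ℝ E H)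
  {M : Type*} [TopologicalSpace M] [ChartedSpace H M]

/-- A smooth structure on the subset `S` (with the subspace topology) for which the inclusion is a
smooth embedding, i.e. which makes `S` an embedded submanifold of `M`. -/
structure SubmanifoldStructure (S : Set M) where
  dim : ℕ
  charted : ChartedSpace (EuclideanSpace ℝ (Fin dim)) S
  isManifold : IsManifold (𝓡 dim) ∞ S
  isSmoothEmbedding : Manifold.IsSmoothEmbedding (𝓡 dim) I ∞ (Subtype.val : S → M)

attribute [instance] SubmanifoldStructure.charted SubmanifoldStructure.isManifold

/-- A smooth structure on the quotient `M / s` (with the quotient topology, which has to be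
Hausdorff and second countable) for which the projection is a smooth submersion, i.e. which makes
`M / s` a quotient manifold of `M`. -/
structure QuotientManifoldStructure (s : Setoid M) where
  dim : ℕ
  charted : ChartedSpace (EuclideanSpace ℝ (Fin dim)) (Quotient s)
  isManifold : IsManifold (𝓡 dim) ∞ (Quotient s)
  t2Space : T2Space (Quotient s)
  secondCountable : SecondCountableTopology (Quotient s)
  isSubmersion : Manifold.IsSubmersion I (𝓡 dim) ∞ (Quotient.mk s : M → Quotient s)

attribute [instance] QuotientManifoldStructure.charted QuotientManifoldStructure.isManifold

end Structures

/-! ## The cotangent bundle -/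

section Cotangent

variable (E : Type*) [NormedAddCommGroup E] [NormedSpace ℝ E]
  (Q : Type*) [TopologicalSpace Q] [ChartedSpace E Q] [IsManifold 𝓘(ℝ, E) ∞ Q]

/-- The cotangent bundle `T^*Q`: its points are pairs `⟨x, α⟩` with `α ∈ T_x^*Q`. Topology and
charts are those of the bundle of continuous linear maps from `TQ` to the trivial line bundle. -/
abbrev Cotangent : Type _ :=
  TotalSpace (E →L[ℝ] ℝ) (fun x : Q => TangentSpace 𝓘(ℝ, E) x →L[ℝ] Bundle.Trivial Q ℝ x)

/-- The model of the manifold `T^*Q`. -/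
abbrev cotangentModel : ModelWithCorners ℝ (E × (E →L[ℝ] ℝ)) (ModelProd E (E →L[ℝ] ℝ)) :=
  𝓘(ℝ, E).prod 𝓘(ℝ, E →L[ℝ] ℝ)

variable {E Q}

/-- The projection `T^*Q → Q`. -/
def cotangentProj : Cotangent E Q → Q := fun α => α.1

/-- The canonical (Liouville) `1`-form, `Θ_α(v) = α(Tτ(v))`. -/
def liouville (α : Cotangent E Q) : TangentSpace (cotangentModel E) α →L[ℝ] ℝ :=
  ContinuousLinearMap.comp (show TangentSpace 𝓘(ℝ, E) α.1 →L[ℝ] ℝ from α.2)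
    (mfderiv (cotangentModel E) 𝓘(ℝ, E) (cotangentProj : Cotangent E Q → Q) α)

variable (E Q) in
/-- The canonical `2`-form `Ω = -dΘ`. -/
def canonicalForm : DForm (cotangentModel E) (Cotangent E Q) 2 := -dForm (oneForm liouville)

end Cotangent

/-! ## Lie group actions -/

section Action

variable {E : Type*} [NormedAddCommGroup E] [NormedSpace ℝ E]
  {Q : Type*} [TopologicalSpace Q] [ChartedSpace E Q] [IsManifold 𝓘(ℝ, E) ∞ Q]
  {V : Type*} [NormedAddCommGroup V] [NormedSpace ℝ V]
  {F : Type*} [TopologicalSpace F] [ChartedSpace V F] [Group F] [MulAction F Q]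

/-- The adjoint action `Ad_h` on the Lie algebra: the derivative at `1` of `g ↦ h g h⁻¹`. -/
def adjointAction (h : F) : GroupLieAlgebra 𝓘(ℝ, V) F →L[ℝ] GroupLieAlgebra 𝓘(ℝ, V) F :=
  (mfderiv 𝓘(ℝ, V) 𝓘(ℝ, V) (fun g : F => h * g * h⁻¹) 1 : V →L[ℝ] V)

variable (E V F) in
/-- The infinitesimal generators at `x`: `ν ↦ ν_Q(x)`, the derivative at `1` of `g ↦ g • x`. -/
def generator (x : Q) : GroupLieAlgebra 𝓘(ℝ, V) F →L[ℝ] TangentSpace 𝓘(ℝ, E) x :=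
  (mfderiv 𝓘(ℝ, V) 𝓘(ℝ, E) (fun g : F => g • x) 1 : V →L[ℝ] E)

/-- The cotangent lift of the action: `h` sends `α ∈ T_x^*Q` to `α ∘ T(h⁻¹) ∈ T_{h x}^*Q`. -/
def cotangentLift (h : F) (α : Cotangent E Q) : Cotangent E Q :=
  ⟨h • α.1, ContinuousLinearMap.comp (show E →L[ℝ] ℝ from α.2)
    (mfderiv 𝓘(ℝ, E) 𝓘(ℝ, E) (fun y : Q => h⁻¹ • y) (h • α.1) : E →L[ℝ] E)⟩

variable (V F) in
/-- The infinitesimal generators of the lifted action: `ν ↦ ν_{T^*Q}(α)`. -/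
def cotangentGenerator (α : Cotangent E Q) :
    GroupLieAlgebra 𝓘(ℝ, V) F →L[ℝ] TangentSpace (cotangentModel E) α :=
  (mfderiv 𝓘(ℝ, V) (cotangentModel E) (fun g : F => cotangentLift g α) 1 :
    V →L[ℝ] E × (E →L[ℝ] ℝ))

variable (V F) in
/-- The canonical momentum map `T^*Q → 𝔣^*`, `⟨J(α), ν⟩ = Θ_α(ν_{T^*Q}(α))`. -/
def momentumMap (α : Cotangent E Q) : GroupLieAlgebra 𝓘(ℝ, V) F →L[ℝ] ℝ :=
  (liouville α).comp (cotangentGenerator V F α)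

/-- The function `J_η(α) = ⟨J(α), η(x)⟩`, `α ∈ T_x^*Q`, of an `𝔣`-valued function `η` on `Q`. -/
def gaugeMomentum (η : Q → GroupLieAlgebra 𝓘(ℝ, V) F) (α : Cotangent E Q) : ℝ :=
  momentumMap V F α (η α.1)

/-- The level set `J⁻¹(m) = {α ∈ T_x^*Q | J(α) = m(x)}` of an `𝔣^*`-valued function `m` on `Q`. -/
def momentumLevel (m : Q → GroupLieAlgebra 𝓘(ℝ, V) F →L[ℝ] ℝ) : Set (Cotangent E Q) :=
  {α | momentumMap V F α = m α.1}

variable (E Q V F) in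
/-- A principal connection on `Q`, as a smooth equivariant `𝔣`-valued `1`-form which reproduces
infinitesimal generators. -/
structure PrincipalConnection where
  form : ∀ x : Q, TangentSpace 𝓘(ℝ, E) x →L[ℝ] GroupLieAlgebra 𝓘(ℝ, V) F
  smooth : ContMDiff 𝓘(ℝ, E) (𝓘(ℝ, E).prod 𝓘(ℝ, E →L[ℝ] V)) ∞
    (fun x : Q => (⟨x, form x⟩ : TotalSpace (E →L[ℝ] V)
      (fun x : Q => TangentSpace 𝓘(ℝ, E) x →L[ℝ] Bundle.Trivial Q V x)))
  form_generator : ∀ (x : Q) (ν : GroupLieAlgebra 𝓘(ℝ, V) F), form x (generator E V F x ν) = ν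
  equivariant : ∀ (h : F) (x : Q) (v : TangentSpace 𝓘(ℝ, E) x),
    form (h • x) (mfderiv 𝓘(ℝ, E) 𝓘(ℝ, E) (fun y : Q => h • y) x v) =
      adjointAction h (form x v)

/-- The map `α ↦ α - ⟨m(x), A_x⟩`, `α ∈ T_x^*Q`. -/
def shiftMap (A : PrincipalConnection E Q V F) (m : Q → GroupLieAlgebra 𝓘(ℝ, V) F →L[ℝ] ℝ)
    (α : Cotangent E Q) : Cotangent E Q :=
  ⟨α.1, (show TangentSpace 𝓘(ℝ, E) α.1 →L[ℝ] ℝ from α.2) - (m α.1).comp (A.form α.1)⟩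

end Action

theorem cotangent_ext {E : Type*} [NormedAddCommGroup E] [NormedSpace ℝ E]
    {Q : Type*} [TopologicalSpace Q] [ChartedSpace E Q] {x y : Q} (hxy : x = y)
    {a b : E →L[ℝ] ℝ} (hab : a = b) : (⟨x, a⟩ : Cotangent E Q) = ⟨y, b⟩ := by
  subst hxy hab
  rfl

section Orbits

variable {E : Type*} [NormedAddCommGroup E] [NormedSpace ℝ E]
  {Q : Type*} [TopologicalSpace Q] [ChartedSpace E Q]
  (V : Type*) [NormedAddCommGroup V] [NormedSpace ℝ V]
  (F : Type*) [TopologicalSpace F] [ChartedSpace V F] [Group F] [MulAction F Q]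

theorem cotangentLift_one {F : Type*} [Group F] [MulAction F Q] (α : Cotangent E Q) :
    cotangentLift (1 : F) α = α := by
  obtain ⟨x, a⟩ := α
  refine cotangent_ext (E := E) (one_smul F x) ?_
  have h : (fun y : Q => (1 : F)⁻¹ • y) = id := by
    funext y
    simp
  rw [h, mfderiv_id]
  rfl

variable {F} in
theorem cotangentLift_mul [ContMDiffSMul 𝓘(ℝ, V) 𝓘(ℝ, E) ∞ F Q] (g h : F) (α : Cotangent E Q) :
    cotangentLift (g * h) α = cotangentLift g (cotangentLift h α) := by
  obtain ⟨x, a⟩ := α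
  refine cotangent_ext (E := E) (mul_smul g h x) ?_
  have hs : ∀ (u : F) (z : Q), MDifferentiableAt 𝓘(ℝ, E) 𝓘(ℝ, E) (fun y : Q => u • y) z := by
    intro u z
    have h1 : ContMDiff 𝓘(ℝ, E) 𝓘(ℝ, E) ∞ (fun y : Q => u • y) :=
      (ContMDiffSMul.contMDiff_smul (I := 𝓘(ℝ, V)) (I' := 𝓘(ℝ, E)) (n := ∞)
        (G := F) (M := Q)).comp (contMDiff_const.prodMk contMDiff_id)
    exact (h1 z).mdifferentiableAt (by simp)
  have hc : (fun y : Q => (g * h)⁻¹ • y) = (fun y : Q => h⁻¹ • y) ∘ (fun y : Q => g⁻¹ • y) := by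
    funext y
    simp [mul_smul]
  have hd := mfderiv_comp ((g * h) • x) (hs h⁻¹ (g⁻¹ • ((g * h) • x))) (hs g⁻¹ ((g * h) • x))
  rw [← hc] at hd
  have hx : g⁻¹ • ((g * h) • x) = h • x := by simp [mul_smul]
  have hy : (g * h) • x = g • h • x := mul_smul g h x
  ext v
  change a (mfderiv 𝓘(ℝ, E) 𝓘(ℝ, E) (fun y : Q => (g * h)⁻¹ • y) ((g * h) • x) v) =
    a (mfderiv 𝓘(ℝ, E) 𝓘(ℝ, E) (fun y : Q => h⁻¹ • y) (h • x)
      (mfderiv 𝓘(ℝ, E) 𝓘(ℝ, E) (fun y : Q => g⁻¹ • y) (g • h • x) v))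
  rw [hd, hx, hy]
  rfl

/-- The relation of lying on the same `F`-orbit on a subset of `T^*Q`. -/
def orbitSetoid [ContMDiffSMul 𝓘(ℝ, V) 𝓘(ℝ, E) ∞ F Q] (S : Set (Cotangent E Q)) : Setoid S where
  r α β := ∃ h : F, cotangentLift h α.1 = β.1
  iseqv :=
    { refl := fun α => ⟨1, cotangentLift_one α.1⟩
      symm := by
        rintro α β ⟨h, hh⟩
        refine ⟨h⁻¹, ?_⟩
        rw [← hh, ← cotangentLift_mul V, inv_mul_cancel, cotangentLift_one]
      trans := by
        rintro α β γ ⟨g, hg⟩ ⟨h, hh⟩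
        refine ⟨h * g, ?_⟩
        rw [cotangentLift_mul V, hg, hh] }

end Orbits

end

/-!
The shift translates each fibre of `T^*Q` by the `1`-form `-⟨m, A⟩`. Translation by `-β` changes
the Liouville form by `-τ^*β`, hence `Ω` by `τ^*dβ`, and `⟨m, A⟩` is `∑ i, c i • Y i` because `Y i`
and `⟨μ i, A⟩` agree on vertical and on horizontal vectors.

The momentum map is `J(α) = α ∘ generator`, and `A` reproduces generators, so `J ∘ Shift = J - m`
and the shift exchanges the levels `m` and `0`. Invariance of the `J_{η i}` means that
`Ad_{h⁻¹} η i(h x) = η i(x)`; as `m` is constant on this frame, it is coadjoint equivariant, so the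
shift and the level sets are compatible with the lifted action. As `J` is a submersion on each
fibre (the generators are injective), the levels are submanifolds. Their quotients are manifolds by
the slice theorem for free proper actions, properness being inherited from `Q`.
-/

noncomputable section

section PartialDiffeomorphisms

variable {E : Type*} [NormedAddCommGroup E] [NormedSpace ℝ E]
  {H : Type*} [TopologicalSpace H] {I : ModelWithCorners ℝ E H}
  {M : Type*} [TopologicalSpace M] [ChartedSpace H M]
  {E' : Type*} [NormedAddCommGroup E'] [NormedSpace ℝ E']
  {H' : Type*} [TopologicalSpace H'] {J : ModelWithCorners ℝ E' H'}
  {N : Type*} [TopologicalSpace N] [ChartedSpace H' N]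
  {E'' : Type*} [NormedAddCommGroup E''] [NormedSpace ℝ E'']
  {H'' : Type*} [TopologicalSpace H''] {K : ModelWithCorners ℝ E'' H''}
  {P : Type*} [TopologicalSpace P] [ChartedSpace H'' P]
  {n : WithTop ℕ∞}

variable (I J n) in
/-- A diffeomorphism between open subsets. Mathlib's `PartialDiffeomorph` bundles the same notion
over `PartialEquiv`; the predicate gives access to the operations on `OpenPartialHomeomorph`. -/
structure IsPartialDiffeomorph (ψ : OpenPartialHomeomorph M N) : Prop where
  contMDiffOn : ContMDiffOn I J n ψ ψ.source
  contMDiffOn_symm : ContMDiffOn J I n ψ.symm ψ.target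

namespace IsPartialDiffeomorph

variable {ψ : OpenPartialHomeomorph M N}

theorem symm (hψ : IsPartialDiffeomorph I J n ψ) : IsPartialDiffeomorph J I n ψ.symm :=
  ⟨hψ.contMDiffOn_symm, hψ.contMDiffOn⟩

theorem trans {χ : OpenPartialHomeomorph N P} (hψ : IsPartialDiffeomorph I J n ψ)
    (hχ : IsPartialDiffeomorph J K n χ) : IsPartialDiffeomorph I K n (ψ ≫ₕ χ) where
  contMDiffOn := hχ.contMDiffOn.comp' hψ.contMDiffOn
  contMDiffOn_symm := hψ.contMDiffOn_symm.comp' hχ.contMDiffOn_symm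

theorem restrOpen (hψ : IsPartialDiffeomorph I J n ψ) {s : Set M} (hs : IsOpen s) :
    IsPartialDiffeomorph I J n (ψ.restrOpen s hs) where
  contMDiffOn := hψ.contMDiffOn.mono Set.inter_subset_left
  contMDiffOn_symm := hψ.contMDiffOn_symm.mono Set.inter_subset_left

theorem contMDiffAt (hψ : IsPartialDiffeomorph I J n ψ) {x : M} (hx : x ∈ ψ.source) :
    ContMDiffAt I J n ψ x :=
  hψ.contMDiffOn.contMDiffAt (ψ.open_source.mem_nhds hx)

theorem isLocalDiffeomorphAt (hψ : IsPartialDiffeomorph I J n ψ) {x : M} (hx : x ∈ ψ.source) :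
    IsLocalDiffeomorphAt I J n ψ x :=
  ⟨⟨ψ.toPartialEquiv, ψ.open_source, ψ.open_target, hψ.contMDiffOn, hψ.contMDiffOn_symm⟩, hx,
    Set.eqOn_refl _ _⟩

end IsPartialDiffeomorph

theorem isPartialDiffeomorph_continuousLinearEquiv (e : E ≃L[ℝ] E') :
    IsPartialDiffeomorph 𝓘(ℝ, E) 𝓘(ℝ, E') n e.toHomeomorph.toOpenPartialHomeomorph :=
  ⟨e.contDiff.contMDiff.contMDiffOn, e.symm.contDiff.contMDiff.contMDiffOn⟩

theorem isPartialDiffeomorph_chartAt [IsManifold I n M] (x : M) :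
    IsPartialDiffeomorph I I n (chartAt H x) :=
  ⟨contMDiffOn_chart, contMDiffOn_chart_symm⟩

theorem isPartialDiffeomorph_modelWithCorners [I.Boundaryless] :
    IsPartialDiffeomorph I 𝓘(ℝ, E) n I.toHomeomorph.toOpenPartialHomeomorph := by
  have h := I.contMDiffOn_symm (n := n)
  rw [I.range_eq_univ] at h
  exact ⟨I.contMDiff.contMDiffOn, h⟩

theorem isPartialDiffeomorph_extChartAt [IsManifold I n M] [I.Boundaryless] (x : M) :
    IsPartialDiffeomorph I 𝓘(ℝ, E) n
      (chartAt H x ≫ₕ I.toHomeomorph.toOpenPartialHomeomorph) :=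
  (isPartialDiffeomorph_chartAt x).trans isPartialDiffeomorph_modelWithCorners

theorem exists_isPartialDiffeomorph {f : M → N} {x : M} (hf : IsLocalDiffeomorphAt I J n f x) :
    ∃ ψ : OpenPartialHomeomorph M N, x ∈ ψ.source ∧ Set.EqOn ψ f ψ.source ∧
      IsPartialDiffeomorph I J n ψ := by
  obtain ⟨Φ, hx, hΦ⟩ := hf
  exact ⟨Φ.toOpenPartialHomeomorph, hx, hΦ.symm, Φ.contMDiffOn_toFun, Φ.contMDiffOn_invFun⟩

theorem isLocalDiffeomorphAt_congr {f g : M → N} {x : M} (hf : IsLocalDiffeomorphAt I J n f x)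
    (hgf : g =ᶠ[𝓝 x] f) : IsLocalDiffeomorphAt I J n g x := by
  obtain ⟨ψ, hx, hψf, hψ⟩ := exists_isPartialDiffeomorph hf
  obtain ⟨U, hU, hUo, hxU⟩ := eventually_nhds_iff.1 hgf
  let χ := ψ.restrOpen U hUo
  have hχ : IsPartialDiffeomorph I J n χ := hψ.restrOpen hUo
  exact ⟨⟨χ.toPartialEquiv, χ.open_source, χ.open_target, hχ.contMDiffOn, hχ.contMDiffOn_symm⟩,
    ⟨hx, hxU⟩, fun y hy => (hU y hy.2).trans (hψf hy.1).symm⟩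

end PartialDiffeomorphisms

section InverseFunctionTheorem

variable {E : Type*} [NormedAddCommGroup E] [NormedSpace ℝ E] [CompleteSpace E]
  {H : Type*} [TopologicalSpace H] {I : ModelWithCorners ℝ E H} [I.Boundaryless]
  {M : Type*} [TopologicalSpace M] [ChartedSpace H M]
  {E' : Type*} [NormedAddCommGroup E'] [NormedSpace ℝ E'] [CompleteSpace E']
  {H' : Type*} [TopologicalSpace H'] {J : ModelWithCorners ℝ E' H'} [J.Boundaryless]
  {N : Type*} [TopologicalSpace N] [ChartedSpace H' N]
  {n : WithTop ℕ∞}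

theorem isLocalDiffeomorphAt_of_bijective_fderiv {g : E → E'} {a : E}
    (hg : ∀ᶠ y in 𝓝 a, ContDiffAt ℝ n g y) (hn : n ≠ 0)
    (hbij : Function.Bijective (fderiv ℝ g a)) :
    IsLocalDiffeomorphAt 𝓘(ℝ, E) 𝓘(ℝ, E') n g a := by
  obtain ⟨O, hgO, hO, ha⟩ := eventually_nhds_iff.1 hg
  have hderiv : ∀ y ∈ O, HasFDerivAt g (fderiv ℝ g y) y := fun y hy =>
    ((hgO y hy).differentiableAt hn).hasFDerivAt
  let L := ContinuousLinearEquiv.ofBijective (fderiv ℝ g a)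
    (LinearMap.ker_eq_bot.2 hbij.1) (LinearMap.range_eq_top.2 hbij.2)
  let R := (hgO a ha).toOpenPartialHomeomorph g (f' := L) (hderiv a ha) hn
  have hcont : ContinuousOn (fderiv ℝ g) O :=
    ContDiffOn.continuousOn_fderiv_of_isOpen (fun y hy => (hgO y hy).contDiffWithinAt) hO
      (ENat.one_le_iff_ne_zero_withTop.2 hn)
  have hopen : IsOpen (O ∩ fderiv ℝ g ⁻¹' Set.range ((↑) : (E ≃L[ℝ] E') → E →L[ℝ] E')) :=
    hcont.isOpen_inter_preimage hO ContinuousLinearEquiv.isOpen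
  let ψ := R.restrOpen _ hopen
  have hψ : IsPartialDiffeomorph 𝓘(ℝ, E) 𝓘(ℝ, E') n ψ := by
    refine ⟨contMDiffOn_iff_contDiffOn.2 fun y hy => (hgO y hy.2.1).contDiffWithinAt,
      contMDiffOn_iff_contDiffOn.2 fun z hz => ?_⟩
    obtain ⟨-, hzO, L', hL'⟩ := ψ.map_target hz
    exact (ψ.contDiffAt_symm hz (hL' ▸ hderiv _ hzO) (hgO _ hzO)).contDiffWithinAt
  exact hψ.isLocalDiffeomorphAt
    ⟨(hgO a ha).mem_toOpenPartialHomeomorph_source (f' := L) (hderiv a ha) hn, ha, L, rfl⟩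

theorem isLocalDiffeomorphAt_of_bijective_mfderiv [IsManifold I n M] [IsManifold J n N]
    {f : M → N} {p : M} (hf : ∀ᶠ x in 𝓝 p, ContMDiffAt I J n f x) (hn : n ≠ 0)
    (hbij : Function.Bijective (mfderiv I J f p)) : IsLocalDiffeomorphAt I J n f p := by
  let φ := chartAt H p ≫ₕ I.toHomeomorph.toOpenPartialHomeomorph
  let χ := chartAt H' (f p) ≫ₕ J.toHomeomorph.toOpenPartialHomeomorph
  have hφ : IsPartialDiffeomorph I 𝓘(ℝ, E) n φ := isPartialDiffeomorph_extChartAt p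
  have hχ : IsPartialDiffeomorph J 𝓘(ℝ, E') n χ := isPartialDiffeomorph_extChartAt (f p)
  have hpφ : p ∈ φ.source := by simp [φ]
  have hfpχ : f p ∈ χ.source := by simp [χ]
  have hfχ : ∀ᶠ x in 𝓝 p, f x ∈ χ.source :=
    hf.self_of_nhds.continuousAt (χ.open_source.mem_nhds hfpχ)
  have hgsmooth : ∀ᶠ y in 𝓝 (φ p), ContDiffAt ℝ n (χ ∘ f ∘ φ.symm) y := by
    have hsymm : Filter.Tendsto φ.symm (𝓝 (φ p)) (𝓝 p) := φ.tendsto_symm hpφ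
    filter_upwards [φ.open_target.mem_nhds (φ.map_source hpφ), hsymm.eventually hf,
      hsymm.eventually hfχ] with y hy hfy hχy
    exact ((hχ.contMDiffAt hχy).comp y (hfy.comp y (hφ.symm.contMDiffAt hy))).contDiffAt
  have hgbij : Function.Bijective (fderiv ℝ (χ ∘ f ∘ φ.symm) (φ p)) := by
    rw [(hf.self_of_nhds.mdifferentiableAt hn).mfderiv, I.range_eq_univ, fderivWithin_univ] at hbij
    exact hbij
  have hg := isLocalDiffeomorphAt_of_bijective_fderiv hgsmooth hn hgbij
  have hgp : (χ ∘ f ∘ φ.symm) (φ p) ∈ χ.symm.source := by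
    rw [Function.comp_apply, Function.comp_apply, φ.left_inv hpφ]
    exact χ.map_source hfpχ
  refine isLocalDiffeomorphAt_congr
    (((hφ.isLocalDiffeomorphAt hpφ).comp _ _ hg).comp J N (hχ.symm.isLocalDiffeomorphAt hgp)) ?_
  filter_upwards [φ.eventually_left_inverse hpφ, hfχ] with x hx hfx
  simp only [Function.comp_apply, hx, χ.left_inv hfx]

end InverseFunctionTheorem

section Slices

variable {M : Type*} [TopologicalSpace M] {B : Type*} [NormedAddCommGroup B]
  {W : Type*} [NormedAddCommGroup W]

/-- The chart of a subset `S` induced by a slice chart `ψ`, i.e. a chart of the ambient manifold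
in which `S` is given by the vanishing of the second component. The point `p` is only used as the
value of the inverse outside of the target. -/
def sliceChart {S : Set M} (ψ : OpenPartialHomeomorph M (B × W))
    (hS : ∀ x ∈ ψ.source, x ∈ S ↔ (ψ x).2 = 0) (p : S) : OpenPartialHomeomorph S B where
  toFun x := (ψ x).1
  invFun y := open Classical in if hy : (y, (0 : W)) ∈ ψ.target then
    ⟨ψ.symm (y, 0), (hS _ (ψ.map_target hy)).2 (by rw [ψ.right_inv hy])⟩ else p
  source := {x | (x : M) ∈ ψ.source}
  target := {y | (y, (0 : W)) ∈ ψ.target}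
  map_source' x hx := by
    have hψx : ((ψ x).1, (0 : W)) = ψ x := Prod.ext rfl ((hS x hx).1 x.2).symm
    exact Set.mem_ofPred_eq ▸ hψx ▸ ψ.map_source hx
  map_target' y hy := by
    simp only [Set.mem_ofPred_eq] at hy ⊢
    rw [dif_pos hy]
    exact ψ.map_target hy
  left_inv' x hx := by
    have hψx : ((ψ x).1, (0 : W)) = ψ x := Prod.ext rfl ((hS x hx).1 x.2).symm
    rw [dif_pos (hψx ▸ ψ.map_source hx)]
    exact Subtype.ext ((congrArg ψ.symm hψx).trans (ψ.left_inv hx))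
  right_inv' y hy := by
    simp only [Set.mem_ofPred_eq] at hy
    rw [dif_pos hy]
    simp only [ψ.right_inv hy]
  open_source := ψ.open_source.preimage continuous_subtype_val
  open_target := ψ.open_target.preimage (by fun_prop)
  continuousOn_toFun := continuous_fst.comp_continuousOn
    (ψ.continuousOn.comp continuous_subtype_val.continuousOn fun _ hx => hx)
  continuousOn_invFun := by
    rw [Topology.IsInducing.subtypeVal.continuousOn_iff]
    have h : ContinuousOn (fun y : B => ψ.symm (y, (0 : W))) {y | (y, (0 : W)) ∈ ψ.target} :=
      ψ.continuousOn_symm.comp (by fun_prop) fun _ hy => hy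
    refine h.congr fun y hy => ?_
    simp only [Set.mem_ofPred_eq] at hy
    simp only [Function.comp_apply, dif_pos hy]

theorem sliceChart_symm_coe {S : Set M} {ψ : OpenPartialHomeomorph M (B × W)}
    (hS : ∀ x ∈ ψ.source, x ∈ S ↔ (ψ x).2 = 0) (p : S) {y : B} (hy : (y, (0 : W)) ∈ ψ.target) :
    (((sliceChart ψ hS p).symm y : S) : M) = ψ.symm (y, 0) := by
  rw [show (sliceChart ψ hS p).symm y = _ from dif_pos hy]

variable {E : Type*} [NormedAddCommGroup E] [NormedSpace ℝ E]
  {H : Type*} [TopologicalSpace H] {I : ModelWithCorners ℝ E H} [ChartedSpace H M]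
  [NormedSpace ℝ B] [NormedSpace ℝ W]

theorem contDiffOn_sliceChart_transition {S : Set M} {ψ χ : OpenPartialHomeomorph M (B × W)}
    (hψS : ∀ x ∈ ψ.source, x ∈ S ↔ (ψ x).2 = 0) (hχS : ∀ x ∈ χ.source, x ∈ S ↔ (χ x).2 = 0)
    {n : WithTop ℕ∞} (hψ : IsPartialDiffeomorph I 𝓘(ℝ, B × W) n ψ)
    (hχ : IsPartialDiffeomorph I 𝓘(ℝ, B × W) n χ) (p q : S) :
    ContDiffOn ℝ n ((sliceChart ψ hψS p).symm ≫ₕ sliceChart χ hχS q)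
      ((sliceChart ψ hψS p).symm ≫ₕ sliceChart χ hχS q).source := by
  have hcomp : ContDiffOn ℝ n (fun y : B => (χ (ψ.symm (y, (0 : W)))).1)
      {y | (y, (0 : W)) ∈ (ψ.symm ≫ₕ χ).source} :=
    (contMDiffOn_iff_contDiffOn.1 (hψ.symm.trans hχ).contMDiffOn).fst.comp
      (contDiff_id.prodMk contDiff_const).contDiffOn fun y hy => hy
  refine (hcomp.mono fun y hy => ?_).congr fun y hy => ?_
  · have hyχ : (((sliceChart ψ hψS p).symm y : S) : M) ∈ χ.source := hy.2
    rw [sliceChart_symm_coe hψS p hy.1] at hyχ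
    exact ⟨hy.1, hyχ⟩
  · exact congrArg (fun x => (χ x).1) (sliceChart_symm_coe hψS p hy.1)

theorem isImmersionAtOfComplement_of_sliceChart [I.Boundaryless] [IsManifold I ∞ M] {d : ℕ}
    {S : Set M} [ChartedSpace (EuclideanSpace ℝ (Fin d)) S]
    {ψ : OpenPartialHomeomorph M (EuclideanSpace ℝ (Fin d) × W)}
    (hψ : IsPartialDiffeomorph I 𝓘(ℝ, EuclideanSpace ℝ (Fin d) × W) ∞ ψ)
    (hS : ∀ x ∈ ψ.source, x ∈ S ↔ (ψ x).2 = 0) {p : S} (hp : (p : M) ∈ ψ.source)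
    (hatlas : sliceChart ψ hS p ∈ IsManifold.maximalAtlas (𝓡 d) ∞ S) :
    Manifold.IsImmersionAtOfComplement W (𝓡 d) I ∞ (Subtype.val : S → M) p := by
  let e : (EuclideanSpace ℝ (Fin d) × W) ≃L[ℝ] E :=
    ((hψ.isLocalDiffeomorphAt hp).mfderivToContinuousLinearEquiv (by simp)).symm
  let κ : OpenPartialHomeomorph M H := (ψ ≫ₕ e.toHomeomorph.toOpenPartialHomeomorph) ≫ₕ
    I.toHomeomorph.toOpenPartialHomeomorph.symm
  have hκ : IsPartialDiffeomorph I I ∞ κ :=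
    (hψ.trans (isPartialDiffeomorph_continuousLinearEquiv e)).trans
      isPartialDiffeomorph_modelWithCorners.symm
  refine .mk_of_charts e (sliceChart ψ hS p) κ hp (by simpa [κ] using hp) hatlas
    (κ.mem_maximalAtlas_of_contMDiffOn hκ.contMDiffOn hκ.contMDiffOn_symm)
    (fun x hx => ⟨⟨hx, trivial⟩, trivial⟩) fun y hy => ?_
  have hyψ : (y, (0 : W)) ∈ ψ.target := (by simpa using hy : y ∈ (sliceChart ψ hS p).target)
  change I (I.symm (e (ψ (((sliceChart ψ hS p).symm y : S) : M)))) = e (y, 0)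
  rw [sliceChart_symm_coe hS p hyψ, ψ.right_inv hyψ, I.right_inv (I.range_eq_univ ▸ Set.mem_univ _)]

theorem nonempty_submanifoldStructure_of_slices [I.Boundaryless] [IsManifold I ∞ M] {d : ℕ}
    {S : Set M} (h : ∀ p : S, ∃ f : M → EuclideanSpace ℝ (Fin d) × W,
      IsLocalDiffeomorphAt I 𝓘(ℝ, EuclideanSpace ℝ (Fin d) × W) ∞ f p ∧
        ∀ x, x ∈ S ↔ (f x).2 = 0) :
    Nonempty (SubmanifoldStructure I S) := by
  choose f hf hfS using h
  choose ψ hp hψf hψ using fun p : S => exists_isPartialDiffeomorph (hf p)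
  have hS : ∀ (p : S), ∀ x ∈ (ψ p).source, x ∈ S ↔ (ψ p x).2 = 0 := fun p x hx =>
    hψf p hx ▸ hfS p x
  let _ : ChartedSpace (EuclideanSpace ℝ (Fin d)) S :=
    { atlas := Set.range fun p => sliceChart (ψ p) (hS p) p
      chartAt := fun p => sliceChart (ψ p) (hS p) p
      mem_chart_source := hp
      chart_mem_atlas := fun p => ⟨p, rfl⟩ }
  have hman : IsManifold (𝓡 d) ∞ S := by
    refine isManifold_of_contDiffOn _ _ _ ?_
    rintro _ _ ⟨p, rfl⟩ ⟨q, rfl⟩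
    exact (contDiffOn_sliceChart_transition (hS p) (hS q) (hψ p) (hψ q) p q).mono
      Set.inter_subset_left
  have himm : Manifold.IsImmersionOfComplement W (𝓡 d) I ∞ (Subtype.val : S → M) := fun p =>
    isImmersionAtOfComplement_of_sliceChart (hψ p) (hS p) (hp p)
      (IsManifold.chart_mem_maximalAtlas p)
  exact ⟨⟨d, _, hman, himm.isImmersion, Topology.IsEmbedding.subtypeVal⟩⟩

end Slices

section RegularLevelSets

theorem exists_bijective_prod_of_surjective {𝕜 E W B : Type*} [NontriviallyNormedField 𝕜]
    [CompleteSpace 𝕜] [NormedAddCommGroup E] [NormedSpace 𝕜 E] [FiniteDimensional 𝕜 E]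
    [NormedAddCommGroup W] [NormedSpace 𝕜 W] [NormedAddCommGroup B] [NormedSpace 𝕜 B]
    [FiniteDimensional 𝕜 B] (D : E →L[𝕜] W) (hD : Function.Surjective D)
    (hB : Module.finrank 𝕜 B + Module.finrank 𝕜 W = Module.finrank 𝕜 E) :
    ∃ P : E →L[𝕜] B, Function.Bijective (P.prod D) := by
  let K := LinearMap.ker (D : E →ₗ[𝕜] W)
  have hDrange : LinearMap.range (D : E →ₗ[𝕜] W) = ⊤ := LinearMap.range_eq_top.2 hD
  have hK : Module.finrank 𝕜 K = Module.finrank 𝕜 B := by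
    have hrank := LinearMap.finrank_range_add_finrank_ker (D : E →ₗ[𝕜] W)
    rw [hDrange, finrank_top] at hrank
    change Module.finrank 𝕜 (LinearMap.ker (D : E →ₗ[𝕜] W)) = _
    omega
  obtain ⟨C, hC⟩ := K.exists_isCompl
  let P : E →ₗ[𝕜] B := (LinearEquiv.ofFinrankEq K B hK).toLinearMap ∘ₗ K.projectionOnto C hC
  have hPrange : LinearMap.range P = ⊤ := LinearMap.range_eq_top.2 <|
    (LinearEquiv.ofFinrankEq K B hK).surjective.comp
      (LinearMap.range_eq_top.1 (Submodule.range_projectionOnto hC))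
  have hPker : LinearMap.ker P = C :=
    (LinearEquiv.ker_comp _ _).trans (Submodule.ker_projectionOnto hC)
  exact ⟨P.toContinuousLinearMap, (LinearMap.equivProdOfSurjectiveOfIsCompl P (D : E →ₗ[𝕜] W)
    hPrange hDrange (hPker ▸ hC.symm)).bijective⟩

variable {E : Type*} [NormedAddCommGroup E] [NormedSpace ℝ E] [FiniteDimensional ℝ E]
  {H : Type*} [TopologicalSpace H] {I : ModelWithCorners ℝ E H} [I.Boundaryless]
  {M : Type*} [TopologicalSpace M] [ChartedSpace H M] [IsManifold I ∞ M]
  {W : Type*} [NormedAddCommGroup W] [NormedSpace ℝ W] [FiniteDimensional ℝ W]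

theorem exists_isLocalDiffeomorphAt_prod_of_surjective_mfderiv {B : Type*} [NormedAddCommGroup B]
    [NormedSpace ℝ B] [FiniteDimensional ℝ B] {G : M → W} (hG : ContMDiff I 𝓘(ℝ, W) ∞ G) {p : M}
    (hp : Function.Surjective (mfderiv I 𝓘(ℝ, W) G p))
    (hB : Module.finrank ℝ B + Module.finrank ℝ W = Module.finrank ℝ E) :
    ∃ g : M → B, IsLocalDiffeomorphAt I 𝓘(ℝ, B × W) ∞ (fun x => (g x, G x)) p := by
  have : CompleteSpace E := FiniteDimensional.complete ℝ E
  have : CompleteSpace W := FiniteDimensional.complete ℝ W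
  have : CompleteSpace B := FiniteDimensional.complete ℝ B
  obtain ⟨P, hP⟩ :=
    exists_bijective_prod_of_surjective (E := E) (W := W) (mfderiv I 𝓘(ℝ, W) G p) hp hB
  have hsmooth : ∀ x ∈ (chartAt H p).source, ContMDiffAt I 𝓘(ℝ, B × W) ∞
      (fun x => (P (extChartAt I p x), G x)) x := fun x hx =>
    (P.contMDiff.contMDiffAt.comp x (contMDiffAt_extChartAt' hx)).prodMk_space (hG x)
  have hchart : HasMFDerivAt I 𝓘(ℝ, E) (extChartAt I p) p (ContinuousLinearMap.id ℝ E) := by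
    have := (mdifferentiableAt_extChartAt (I := I) (mem_chart_source H p)).hasMFDerivAt
    rwa [mfderiv_extChartAt_self] at this
  have hPchart : HasMFDerivAt I 𝓘(ℝ, B) (fun x => P (extChartAt I p x)) p P :=
    P.hasMFDerivAt.comp p hchart
  have hGp := ((hG p).mdifferentiableAt (by simp)).hasMFDerivAt
  have hderiv : HasMFDerivAt I 𝓘(ℝ, B × W) (fun x => (P (extChartAt I p x), G x)) p
      (P.prod (mfderiv I 𝓘(ℝ, W) G p : E →L[ℝ] W)) :=
    ⟨hPchart.1.prodMk hGp.1, hPchart.2.prodMk hGp.2⟩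
  refine ⟨fun x => P (extChartAt I p x), isLocalDiffeomorphAt_of_bijective_mfderiv ?_ (by simp) ?_⟩
  · exact Filter.mem_of_superset (chart_source_mem_nhds H p) hsmooth
  · rw [hderiv.mfderiv]
    exact hP

theorem nonempty_submanifoldStructure_of_regular {G : M → W} (hG : ContMDiff I 𝓘(ℝ, W) ∞ G)
    (hreg : ∀ p, G p = 0 → Function.Surjective (mfderiv I 𝓘(ℝ, W) G p)) :
    Nonempty (SubmanifoldStructure I {p | G p = 0}) := by
  refine nonempty_submanifoldStructure_of_slices (W := W)
    (d := Module.finrank ℝ E - Module.finrank ℝ W) fun ⟨p, hp⟩ => ?_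
  have hdim : Module.finrank ℝ W ≤ Module.finrank ℝ E :=
    LinearMap.finrank_le_finrank_of_surjective (M := E)
      (f := (mfderiv I 𝓘(ℝ, W) G p).toLinearMap) (hreg p hp)
  obtain ⟨g, hg⟩ := exists_isLocalDiffeomorphAt_prod_of_surjective_mfderiv hG (hreg p hp)
    (B := EuclideanSpace ℝ (Fin (Module.finrank ℝ E - Module.finrank ℝ W)))
    (by rw [finrank_euclideanSpace_fin]; omega)
  exact ⟨_, hg, fun x => Iff.rfl⟩

end RegularLevelSets

section AdaptedCharts

variable {M B W : Type*} [TopologicalSpace M] [TopologicalSpace B] [TopologicalSpace W]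
  {s : Setoid M}

/-- `ψ` is adapted to the equivalence relation `s` at `p` if on its source the classes of `s` are
the fibres of the first component, and if its target contains the projection of each of its points
to the slice through the second component of `ψ p`. This slice parametrizes the quotient. -/
structure IsAdapted (s : Setoid M) (ψ : OpenPartialHomeomorph M (B × W)) (p : M) : Prop where
  rel_iff : ∀ x ∈ ψ.source, ∀ y ∈ ψ.source, s x y ↔ (ψ x).1 = (ψ y).1
  slice_mem : ∀ z ∈ ψ.target, (z.1, (ψ p).2) ∈ ψ.target

theorem IsAdapted.trans_prod {N : Type*} [TopologicalSpace N] {p : M}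
    {ψ : OpenPartialHomeomorph M (B × N)} (hψ : IsAdapted s ψ p) {κ : OpenPartialHomeomorph N W}
    (hκ : (ψ p).2 ∈ κ.source) :
    IsAdapted s (ψ ≫ₕ (OpenPartialHomeomorph.refl B).prod κ) p where
  rel_iff x hx y hy := hψ.rel_iff x hx.1 y hy.1
  slice_mem := by
    rintro z ⟨-, hzψ⟩
    refine ⟨⟨trivial, κ.map_source hκ⟩, ?_⟩
    have hmem : (z.1, (ψ p).2) ∈ ψ.target := hψ.slice_mem _ hzψ
    change (z.1, κ.symm (κ (ψ p).2)) ∈ ψ.target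
    rwa [κ.left_inv hκ]

open Classical in
/-- The map induced on the quotient by the first component of an adapted chart, extended by a
constant to the classes which do not meet the source. -/
def adaptedFun (s : Setoid M) (ψ : OpenPartialHomeomorph M (B × W)) (p : M) (q : Quotient s) : B :=
  if h : ∃ x ∈ ψ.source, Quotient.mk s x = q then (ψ h.choose).1 else (ψ p).1

theorem adaptedFun_mk {ψ : OpenPartialHomeomorph M (B × W)} {p : M} (h : IsAdapted s ψ p)
    {x y : M} (hx : x ∈ ψ.source) (hxy : s x y) :
    adaptedFun s ψ p (Quotient.mk s y) = (ψ x).1 := by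
  have hex : ∃ x ∈ ψ.source, Quotient.mk s x = Quotient.mk s y := ⟨x, hx, Quotient.sound hxy⟩
  rw [adaptedFun, dif_pos hex]
  exact (h.rel_iff _ hex.choose_spec.1 _ hx).1
    (s.trans (Quotient.exact hex.choose_spec.2) (s.symm hxy))

theorem continuousOn_adaptedFun (hs : IsOpenMap (Quotient.mk s))
    {ψ : OpenPartialHomeomorph M (B × W)} {p : M} (h : IsAdapted s ψ p) :
    ContinuousOn (adaptedFun s ψ p) (Quotient.mk s '' ψ.source) := by
  rintro _ ⟨x, hx, rfl⟩
  have hcomp : Filter.Tendsto (adaptedFun s ψ p ∘ Quotient.mk s) (𝓝 x)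
      (𝓝 (adaptedFun s ψ p (Quotient.mk s x))) := by
    rw [adaptedFun_mk h hx (s.refl x)]
    refine (continuous_fst.continuousAt.tendsto.comp (ψ.continuousAt hx)).congr' ?_
    filter_upwards [ψ.open_source.mem_nhds hx] with y hy
    exact (adaptedFun_mk h hy (s.refl y)).symm
  exact ContinuousAt.continuousWithinAt ((Filter.tendsto_map'_iff.2 hcomp).mono_left (hs.nhds_le x))

/-- The chart of the quotient induced by an adapted chart. -/
def adaptedChart (hs : IsOpenMap (Quotient.mk s)) {ψ : OpenPartialHomeomorph M (B × W)} {p : M}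
    (h : IsAdapted s ψ p) : OpenPartialHomeomorph (Quotient s) B where
  toFun := adaptedFun s ψ p
  invFun y := Quotient.mk s (ψ.symm (y, (ψ p).2))
  source := Quotient.mk s '' ψ.source
  target := {y | (y, (ψ p).2) ∈ ψ.target}
  map_source' := by
    rintro _ ⟨x, hx, rfl⟩
    rw [adaptedFun_mk h hx (s.refl x)]
    exact h.slice_mem _ (ψ.map_source hx)
  map_target' y hy := ⟨_, ψ.map_target hy, rfl⟩
  left_inv' := by
    rintro _ ⟨x, hx, rfl⟩
    rw [adaptedFun_mk h hx (s.refl x)]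
    have hslice := h.slice_mem _ (ψ.map_source hx)
    exact Quotient.sound ((h.rel_iff _ (ψ.map_target hslice) _ hx).2 (by rw [ψ.right_inv hslice]))
  right_inv' y hy := by
    rw [adaptedFun_mk h (ψ.map_target hy) (s.refl _), ψ.right_inv hy]
  open_source := hs _ ψ.open_source
  open_target := ψ.open_target.preimage (by fun_prop)
  continuousOn_toFun := continuousOn_adaptedFun hs h
  continuousOn_invFun := continuous_quotient_mk'.comp_continuousOn
    (ψ.continuousOn_symm.comp (by fun_prop) fun _ hy => hy)

end AdaptedCharts

section QuotientManifolds

variable {E : Type*} [NormedAddCommGroup E] [NormedSpace ℝ E]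
  {H : Type*} [TopologicalSpace H] {I : ModelWithCorners ℝ E H}
  {M : Type*} [TopologicalSpace M] [ChartedSpace H M]
  {B : Type*} [NormedAddCommGroup B] [NormedSpace ℝ B]
  {W : Type*} [NormedAddCommGroup W] [NormedSpace ℝ W] {s : Setoid M}

theorem contMDiffAt_adaptedFun_mk {ψ : OpenPartialHomeomorph M (B × W)} {p : M}
    (hψ : IsPartialDiffeomorph I 𝓘(ℝ, B × W) ∞ ψ) (h : IsAdapted s ψ p)
    (hhom : ∀ x y, s x y → ∃ f : M → M, ContMDiffAt I I ∞ f x ∧ f x = y ∧ ∀ᶠ z in 𝓝 x, s z (f z))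
    {x : M} (hx : Quotient.mk s x ∈ Quotient.mk s '' ψ.source) :
    ContMDiffAt I 𝓘(ℝ, B) ∞ (fun z => adaptedFun s ψ p (Quotient.mk s z)) x := by
  obtain ⟨y, hy, hyx⟩ := hx
  obtain ⟨f, hf, rfl, hsf⟩ := hhom x y (Quotient.exact hyx.symm)
  have hfst : ContMDiffAt I 𝓘(ℝ, B) ∞ (fun z => (ψ (f z)).1) x :=
    contDiff_fst.contMDiff.contMDiffAt.comp x ((hψ.contMDiffAt hy).comp x hf)
  refine hfst.congr_of_eventuallyEq ?_
  filter_upwards [hf.continuousAt (ψ.open_source.mem_nhds hy), hsf] with z hz hsz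
  exact adaptedFun_mk h hz (s.symm hsz)

theorem contDiffOn_adaptedChart_transition (hs : IsOpenMap (Quotient.mk s))
    {ψ χ : OpenPartialHomeomorph M (B × W)} {p q : M}
    (hψ : IsPartialDiffeomorph I 𝓘(ℝ, B × W) ∞ ψ) (hχ : IsPartialDiffeomorph I 𝓘(ℝ, B × W) ∞ χ)
    (hψp : IsAdapted s ψ p) (hχq : IsAdapted s χ q)
    (hhom : ∀ x y, s x y → ∃ f : M → M, ContMDiffAt I I ∞ f x ∧ f x = y ∧ ∀ᶠ z in 𝓝 x, s z (f z)) :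
    ContDiffOn ℝ ∞ ((adaptedChart hs hψp).symm ≫ₕ adaptedChart hs hχq)
      ((adaptedChart hs hψp).symm ≫ₕ adaptedChart hs hχq).source := by
  rintro y ⟨hy, hyχ⟩
  have hslice : ContMDiffAt 𝓘(ℝ, B) I ∞ (fun y => ψ.symm (y, (ψ p).2)) y :=
    (hψ.symm.contMDiffAt hy).comp y
      (contDiff_id.prodMk contDiff_const).contMDiff.contMDiffAt
  exact ((contMDiffAt_adaptedFun_mk hχ hχq hhom hyχ).comp y hslice).contDiffAt.contDiffWithinAt

theorem isSubmersionAtOfComplement_of_adaptedChart [I.Boundaryless] [IsManifold I ∞ M] {d : ℕ}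
    [ChartedSpace (EuclideanSpace ℝ (Fin d)) (Quotient s)] (hs : IsOpenMap (Quotient.mk s))
    {ψ : OpenPartialHomeomorph M (EuclideanSpace ℝ (Fin d) × W)} {p : M} (hp : p ∈ ψ.source)
    (hψ : IsPartialDiffeomorph I 𝓘(ℝ, EuclideanSpace ℝ (Fin d) × W) ∞ ψ) (h : IsAdapted s ψ p)
    (hatlas : adaptedChart hs h ∈ IsManifold.maximalAtlas (𝓡 d) ∞ (Quotient s)) :
    Manifold.IsSubmersionAtOfComplement W I (𝓡 d) ∞ (Quotient.mk s) p := by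
  let e : (EuclideanSpace ℝ (Fin d) × W) ≃L[ℝ] E :=
    ((hψ.isLocalDiffeomorphAt hp).mfderivToContinuousLinearEquiv (by simp)).symm
  let κ : OpenPartialHomeomorph M H := (ψ ≫ₕ e.toHomeomorph.toOpenPartialHomeomorph) ≫ₕ
    I.toHomeomorph.toOpenPartialHomeomorph.symm
  have hκ : IsPartialDiffeomorph I I ∞ κ :=
    (hψ.trans (isPartialDiffeomorph_continuousLinearEquiv e)).trans
      isPartialDiffeomorph_modelWithCorners.symm
  refine .mk_of_charts e.symm κ (adaptedChart hs h) (by simpa [κ] using hp) ⟨p, hp, rfl⟩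
    (κ.mem_maximalAtlas_of_contMDiffOn hκ.contMDiffOn hκ.contMDiffOn_symm) hatlas
    (fun x hx => ⟨x, hx.1.1, rfl⟩) fun y hy => ?_
  have hI : I (I.symm y) = y := I.right_inv (I.range_eq_univ ▸ Set.mem_univ _)
  have hyψ : e.symm y ∈ ψ.target := hI ▸ hy.2.2.2
  change adaptedFun s ψ p (Quotient.mk s (ψ.symm (e.symm (I (I.symm y))))) = (e.symm y).1
  rw [hI, adaptedFun_mk h (ψ.map_target hyψ) (s.refl _), ψ.right_inv hyψ]

theorem nonempty_quotientManifoldStructure_of_adapted [I.Boundaryless] [IsManifold I ∞ M]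
    [SecondCountableTopology M] [T2Space (Quotient s)] (hs : IsOpenMap (Quotient.mk s)) {d : ℕ}
    (h : ∀ p : M, ∃ ψ : OpenPartialHomeomorph M (EuclideanSpace ℝ (Fin d) × W), p ∈ ψ.source ∧
      IsPartialDiffeomorph I 𝓘(ℝ, EuclideanSpace ℝ (Fin d) × W) ∞ ψ ∧ IsAdapted s ψ p)
    (hhom : ∀ x y, s x y →
      ∃ f : M → M, ContMDiffAt I I ∞ f x ∧ f x = y ∧ ∀ᶠ z in 𝓝 x, s z (f z)) :
    Nonempty (QuotientManifoldStructure I s) := by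
  choose ψ hp hψ hA using h
  let _ : ChartedSpace (EuclideanSpace ℝ (Fin d)) (Quotient s) :=
    { atlas := Set.range fun p => adaptedChart hs (hA p)
      chartAt := fun q => adaptedChart hs (hA q.out)
      mem_chart_source := fun q => ⟨q.out, hp _, Quotient.out_eq q⟩
      chart_mem_atlas := fun q => ⟨q.out, rfl⟩ }
  have hman : IsManifold (𝓡 d) ∞ (Quotient s) := by
    refine isManifold_of_contDiffOn _ _ _ ?_
    rintro _ _ ⟨p, rfl⟩ ⟨q, rfl⟩
    exact (contDiffOn_adaptedChart_transition hs (hψ p) (hψ q) (hA p) (hA q) hhom).mono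
      Set.inter_subset_left
  have hsub : Manifold.IsSubmersionOfComplement W I (𝓡 d) ∞ (Quotient.mk s) := fun p =>
    isSubmersionAtOfComplement_of_adaptedChart hs (hp p) (hψ p) (hA p)
      (IsManifold.subset_maximalAtlas ⟨p, rfl⟩)
  exact ⟨⟨d, _, hman, inferInstance,
    (isQuotientMap_quotient_mk' (s := s)).secondCountableTopology hs, hsub.isSubmersion⟩⟩

end QuotientManifolds

section SmoothActions

theorem exists_bijective_coprod_of_injective {𝕜 E V B : Type*} [NontriviallyNormedField 𝕜]
    [CompleteSpace 𝕜] [NormedAddCommGroup E] [NormedSpace 𝕜 E] [FiniteDimensional 𝕜 E]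
    [NormedAddCommGroup V] [NormedSpace 𝕜 V] [NormedAddCommGroup B] [NormedSpace 𝕜 B]
    [FiniteDimensional 𝕜 B] (D : V →L[𝕜] E) (hD : Function.Injective D)
    (hB : Module.finrank 𝕜 B + Module.finrank 𝕜 V = Module.finrank 𝕜 E) :
    ∃ ι : B →L[𝕜] E, Function.Bijective (ι.coprod D) := by
  let R := LinearMap.range (D : V →ₗ[𝕜] E)
  obtain ⟨C, hC⟩ := R.exists_isCompl
  have hR : Module.finrank 𝕜 R = Module.finrank 𝕜 V :=
    LinearMap.finrank_range_of_inj (f := (D : V →ₗ[𝕜] E)) hD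
  have hRC := Submodule.finrank_add_eq_of_isCompl hC
  let ε : B ≃ₗ[𝕜] C := LinearEquiv.ofFinrankEq B C (by omega)
  let δ : V ≃ₗ[𝕜] R := LinearEquiv.ofInjective (D : V →ₗ[𝕜] E) hD
  exact ⟨(C.subtype ∘ₗ ε.toLinearMap).toContinuousLinearMap,
    ((ε.prodCongr δ).trans (Submodule.prodEquivOfIsCompl C R hC.symm)).bijective⟩

theorem IsPartialDiffeomorph.refl_prod {V : Type*} [NormedAddCommGroup V] [NormedSpace ℝ V]
    {H : Type*} [TopologicalSpace H] {K : ModelWithCorners ℝ V H}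
    {F : Type*} [TopologicalSpace F] [ChartedSpace H F]
    {B : Type*} [NormedAddCommGroup B] [NormedSpace ℝ B] {n : WithTop ℕ∞}
    {κ : OpenPartialHomeomorph F V} (hκ : IsPartialDiffeomorph K 𝓘(ℝ, V) n κ) :
    IsPartialDiffeomorph (𝓘(ℝ, B).prod K) 𝓘(ℝ, B × V) n
      ((OpenPartialHomeomorph.refl B).prod κ) where
  contMDiffOn := contMDiffOn_fst.prodMk_space
    (hκ.contMDiffOn.comp contMDiffOn_snd fun _ hz => hz.2)
  contMDiffOn_symm := contDiff_fst.contMDiff.contMDiffOn.prodMk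
    (hκ.contMDiffOn_symm.comp contDiff_snd.contMDiff.contMDiffOn fun _ hz => hz.2)

theorem exists_nhds_smul_mem {F M : Type*} [TopologicalSpace F] [Group F] [TopologicalSpace M]
    [MulAction F M] [ProperSMul F M] (hfree : ∀ (h : F) (x : M), h • x = x → h = 1)
    (p : M) {W : Set F} (hW : W ∈ 𝓝 1) :
    ∃ N ∈ 𝓝 p, ∀ (g : F), ∀ x ∈ N, g • x ∈ N → g ∈ W := by
  let f : F × M → M × M := fun gx => (gx.1 • gx.2, gx.2)
  have hclosed : IsClosed (f '' (interior W ×ˢ (Set.univ : Set M))ᶜ) :=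
    (ProperSMul.isProperMap_smul_pair (G := F) (X := M)).isClosedMap _
      (isOpen_interior.prod isOpen_univ).isClosed_compl
  have hp : (p, p) ∉ f '' (interior W ×ˢ (Set.univ : Set M))ᶜ := by
    rintro ⟨⟨g, x⟩, hgx, hfgx⟩
    obtain ⟨hg, rfl⟩ : g • x = p ∧ x = p := Prod.ext_iff.1 hfgx
    exact hgx ⟨hfree g x hg ▸ mem_interior_iff_mem_nhds.2 hW, trivial⟩
  obtain ⟨N₁, hN₁, N₂, hN₂, hN⟩ := mem_nhds_prod_iff.1 (hclosed.isOpen_compl.mem_nhds hp)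
  refine ⟨N₁ ∩ N₂, Filter.inter_mem hN₁ hN₂, fun g x hx hgx => interior_subset ?_⟩
  by_contra hg
  exact hN ⟨hgx.1, hx.2⟩ ⟨(g, x), fun h => hg h.1, rfl⟩

theorem exists_isAdapted_orbitRel {F M B : Type*} [TopologicalSpace F] [Group F]
    [TopologicalSpace M] [TopologicalSpace B] [MulAction F M] [ProperSMul F M]
    (hfree : ∀ (h : F) (x : M), h • x = x → h = 1) {θ : OpenPartialHomeomorph (B × F) M}
    {σ : B → M} {b : B} (hb : (b, 1) ∈ θ.source) (hθ : ∀ z ∈ θ.source, θ z = z.2 • σ z.1) :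
    ∃ (U : Set (B × F)) (hU : IsOpen U), (b, 1) ∈ U ∧
      IsAdapted (MulAction.orbitRel F M) (θ.restrOpen U hU).symm (σ b) := by
  obtain ⟨B₀, W, hB₀, hW, hbB₀, h1W, hBW⟩ := isOpen_prod_iff.1 θ.open_source b 1 hb
  have hσθ : ∀ y ∈ B₀, θ (y, 1) = σ y := fun y hy => by rw [hθ _ (hBW ⟨hy, h1W⟩), one_smul]
  obtain ⟨N, hN, hNW⟩ := exists_nhds_smul_mem hfree (σ b) (hW.mem_nhds h1W)
  have hσ : ContinuousAt σ b :=
    ((θ.continuousAt hb).comp (f := fun y : B => (y, (1 : F))) (by fun_prop)).congr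
      (Filter.eventuallyEq_of_mem (hB₀.mem_nhds hbB₀) hσθ)
  obtain ⟨B₁, hB₁, hB₁o, hbB₁⟩ := mem_nhds_iff.1 (Filter.inter_mem (hB₀.mem_nhds hbB₀) (hσ hN))
  have hsep : ∀ y ∈ B₁, ∀ y' ∈ B₁, ∀ g : F, g • σ y = σ y' → y = y' := by
    intro y hy y' hy' g hg
    have hgW : g ∈ W := hNW g (σ y) (hB₁ hy).2 (hg ▸ (hB₁ hy').2)
    have hgy : (y, g) ∈ θ.source := hBW ⟨(hB₁ hy).1, hgW⟩
    have hy1 : (y', (1 : F)) ∈ θ.source := hBW ⟨(hB₁ hy').1, h1W⟩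
    exact congrArg Prod.fst (θ.injOn hgy hy1 (by rw [hθ _ hgy, hθ _ hy1, hg, one_smul]))
  have hbU : (b, 1) ∈ B₁ ×ˢ W := ⟨hbB₁, h1W⟩
  refine ⟨B₁ ×ˢ W, hB₁o.prod hW, hbU, ⟨fun x hx x' hx' => ?_, fun z hz => ?_⟩⟩
  · set χ := θ.restrOpen (B₁ ×ˢ W) (hB₁o.prod hW)
    have hz : χ.symm x ∈ χ.source := χ.map_target hx
    have hz' : χ.symm x' ∈ χ.source := χ.map_target hx'
    have hxσ : (χ.symm x).2 • σ (χ.symm x).1 = x := (hθ _ hz.1).symm.trans (χ.right_inv hx)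
    have hxσ' : (χ.symm x').2 • σ (χ.symm x').1 = x' := (hθ _ hz'.1).symm.trans (χ.right_inv hx')
    change x ∈ MulAction.orbit F x' ↔ _
    refine ⟨fun ⟨g, hg⟩ => hsep _ hz.2.1 _ hz'.2.1 ((χ.symm x').2⁻¹ * g⁻¹ * (χ.symm x).2) ?_,
      fun h => ⟨(χ.symm x).2 * (χ.symm x').2⁻¹, ?_⟩⟩
    · change g • x' = x at hg
      rw [mul_smul, mul_smul, hxσ, inv_smul_eq_iff, hxσ', inv_smul_eq_iff, hg]
    · change ((χ.symm x).2 * (χ.symm x').2⁻¹) • x' = x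
      rw [mul_smul, inv_smul_eq_iff.2 hxσ'.symm, ← h, hxσ]
  · have hσb : θ.symm (σ b) = (b, 1) := by rw [← hσθ b hbB₀, θ.left_inv hb]
    change (z.1, (θ.symm (σ b)).2) ∈ θ.source ∩ B₁ ×ˢ W
    rw [hσb]
    exact ⟨hBW ⟨(hB₁ hz.2.1).1, h1W⟩, hz.2.1, h1W⟩

variable {E : Type*} [NormedAddCommGroup E] [NormedSpace ℝ E]
  {H : Type*} [TopologicalSpace H] {I : ModelWithCorners ℝ E H} [I.Boundaryless]
  {M : Type*} [TopologicalSpace M] [ChartedSpace H M] [IsManifold I ∞ M]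

theorem exists_hasMFDerivAt_zero {B : Type*} [NormedAddCommGroup B] [NormedSpace ℝ B]
    (ι : B →L[ℝ] E) (p : M) :
    ∃ σ : B → M, σ 0 = p ∧ (∀ᶠ y in 𝓝 0, ContMDiffAt 𝓘(ℝ, B) I ∞ σ y) ∧
      HasMFDerivAt 𝓘(ℝ, B) I σ 0 ι := by
  let φ := chartAt H p ≫ₕ I.toHomeomorph.toOpenPartialHomeomorph
  have hφ : IsPartialDiffeomorph I 𝓘(ℝ, E) ∞ φ := isPartialDiffeomorph_extChartAt p
  have hp : p ∈ φ.source := by simp [φ]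
  have hsymm : HasMFDerivAt 𝓘(ℝ, E) I φ.symm (φ p + ι 0) (ContinuousLinearMap.id ℝ E) := by
    rw [map_zero, add_zero]
    have h := mfderivWithin_range_extChartAt_symm (I := I) (x := p)
    rw [I.range_eq_univ, mfderivWithin_univ] at h
    exact h ▸ ((hφ.symm.contMDiffAt (φ.map_source hp)).mdifferentiableAt (by simp)).hasMFDerivAt
  have hline : HasMFDerivAt 𝓘(ℝ, B) 𝓘(ℝ, E) (fun y => φ p + ι y) 0 ι :=
    (ι.hasFDerivAt.const_add (φ p)).hasMFDerivAt
  refine ⟨fun y => φ.symm (φ p + ι y), by simp [φ.left_inv hp], ?_, hsymm.comp 0 hline⟩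
  have hopen : IsOpen {y | φ p + ι y ∈ φ.target} := φ.open_target.preimage (by fun_prop)
  filter_upwards [hopen.mem_nhds (by simpa using φ.map_source hp : (0 : B) ∈ _)] with y hy
  exact (hφ.symm.contMDiffAt hy).comp y (contDiff_const.add ι.contDiff).contMDiff.contMDiffAt

variable [FiniteDimensional ℝ E]
  {V : Type*} [NormedAddCommGroup V] [NormedSpace ℝ V]
  {G : Type*} [TopologicalSpace G] {K : ModelWithCorners ℝ V G} [K.Boundaryless]
  {F : Type*} [TopologicalSpace F] [ChartedSpace G F] [Group F] [LieGroup K ∞ F]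
  [MulAction F M] [ContMDiffSMul K I ∞ F M]

theorem exists_isLocalDiffeomorphAt_smul_slice {B : Type*} [NormedAddCommGroup B]
    [NormedSpace ℝ B] [FiniteDimensional ℝ B] (p : M)
    (hgen : Function.Injective (mfderiv K I (fun g : F => g • p) 1))
    (hB : Module.finrank ℝ B + Module.finrank ℝ V = Module.finrank ℝ E) :
    ∃ σ : B → M, σ 0 = p ∧
      IsLocalDiffeomorphAt (𝓘(ℝ, B).prod K) I ∞ (fun z : B × F => z.2 • σ z.1) (0, 1) := by
  let D : V →L[ℝ] E := mfderiv K I (fun g : F => g • p) 1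
  have : FiniteDimensional ℝ V := Module.Finite.of_injective D.toLinearMap hgen
  have : CompleteSpace E := FiniteDimensional.complete ℝ E
  have : CompleteSpace V := FiniteDimensional.complete ℝ V
  have : CompleteSpace B := FiniteDimensional.complete ℝ B
  obtain ⟨ι, hι⟩ := exists_bijective_coprod_of_injective D hgen hB
  obtain ⟨σ, hσ0, hσ, hdσ⟩ := exists_hasMFDerivAt_zero (I := I) ι p
  have hsmul : ContMDiff (K.prod I) I ∞ (fun z : F × M => z.1 • z.2) :=
    ContMDiffSMul.contMDiff_smul
  have hf : ∀ᶠ z in 𝓝 ((0, 1) : B × F),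
      ContMDiffAt (𝓘(ℝ, B).prod K) I ∞ (fun z : B × F => z.2 • σ z.1) z := by
    filter_upwards [continuous_fst.continuousAt.eventually hσ] with z hz
    exact (hsmul (z.2, σ z.1)).comp z (contMDiffAt_snd.prodMk (hz.comp z contMDiffAt_fst))
  refine ⟨σ, hσ0, isLocalDiffeomorphAt_of_bijective_mfderiv hf (by simp) ?_⟩
  have hdf : (mfderiv (𝓘(ℝ, B).prod K) I (fun z : B × F => z.2 • σ z.1) (0, 1) : B × V → E) =
      ι.coprod D := by
    funext v
    refine (mfderiv_prod_eq_add_apply (hf.self_of_nhds.mdifferentiableAt (by simp))).trans ?_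
    have hone : (fun y => (1 : F) • σ y) = σ := funext fun y => one_smul F (σ y)
    have hdσ' : (mfderiv 𝓘(ℝ, B) I (fun y => (1 : F) • σ y) 0 : B →L[ℝ] E) = ι := by
      rw [hone]
      exact hdσ.mfderiv
    have hdorbit : (mfderiv K I (fun g : F => g • σ 0) 1 : V →L[ℝ] E) = D := by
      rw [hσ0]
    exact congrArg₂ (· + ·) (congrArg (fun T : B →L[ℝ] E => T v.1) hdσ')
      (congrArg (fun T : V →L[ℝ] E => T v.2) hdorbit)
  exact hdf ▸ hι

theorem nonempty_quotientManifoldStructure_orbitRel [SecondCountableTopology M] [ProperSMul F M]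
    (hfree : ∀ (h : F) (x : M), h • x = x → h = 1)
    (hgen : ∀ p : M, Function.Injective (mfderiv K I (fun g : F => g • p) 1)) :
    Nonempty (QuotientManifoldStructure I (MulAction.orbitRel F M)) := by
  have : ContinuousConstSMul F M :=
    ⟨fun h => (ContMDiffSMul.contMDiff_const_smul (I := K) (I' := I) (n := ∞) h).continuous⟩
  refine nonempty_quotientManifoldStructure_of_adapted (W := V)
    (d := Module.finrank ℝ E - Module.finrank ℝ V) isOpenMap_quotient_mk'_mul (fun p => ?_) ?_
  · have hdim : Module.finrank ℝ V ≤ Module.finrank ℝ E :=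
      LinearMap.finrank_le_finrank_of_injective (M := V) (M' := E)
        (f := (mfderiv K I (fun g : F => g • p) 1).toLinearMap) (hgen p)
    obtain ⟨σ, hσ0, hσ⟩ := exists_isLocalDiffeomorphAt_smul_slice p (hgen p)
      (B := EuclideanSpace ℝ (Fin (Module.finrank ℝ E - Module.finrank ℝ V)))
      (by rw [finrank_euclideanSpace_fin]; omega)
    obtain ⟨θ, h01, hθσ, hθ⟩ := exists_isPartialDiffeomorph hσ
    obtain ⟨U, hU, h01U, hA⟩ := exists_isAdapted_orbitRel hfree h01 hθσ
    let κ := chartAt G (1 : F) ≫ₕ K.toHomeomorph.toOpenPartialHomeomorph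
    have hθ0 : θ (0, 1) = p := (hθσ h01).trans ((one_smul F (σ 0)).trans hσ0)
    have hθp : θ.symm p = (0, 1) := by rw [← hθ0, θ.left_inv h01]
    have h1κ : (θ.symm p).2 ∈ κ.source := by simp [hθp, κ]
    refine ⟨_, ?_, (hθ.restrOpen hU).symm.trans (isPartialDiffeomorph_extChartAt 1).refl_prod,
      (hσ0 ▸ hA).trans_prod h1κ⟩
    have hpt : p ∈ (θ.restrOpen U hU).target :=
      hθ0 ▸ (θ.restrOpen U hU).map_source ⟨h01, h01U⟩
    exact ⟨hpt, trivial, h1κ⟩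
  · rintro x y ⟨h, rfl⟩
    exact ⟨fun z => h⁻¹ • z, ContMDiffSMul.contMDiff_const_smul (I := K) h⁻¹ _,
      inv_smul_smul h y, .of_forall fun z => ⟨h, smul_inv_smul h z⟩⟩

end SmoothActions

section Submersions

variable {E : Type*} [NormedAddCommGroup E] [NormedSpace ℝ E]
  {H : Type*} [TopologicalSpace H] {I : ModelWithCorners ℝ E H}
  {M : Type*} [TopologicalSpace M] [ChartedSpace H M] {n : WithTop ℕ∞}

theorem isPartialDiffeomorph_of_mem_maximalAtlas {φ : OpenPartialHomeomorph M H}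
    (hφ : φ ∈ IsManifold.maximalAtlas I n M) : IsPartialDiffeomorph I I n φ :=
  ⟨contMDiffOn_of_mem_maximalAtlas hφ, contMDiffOn_symm_of_mem_maximalAtlas hφ⟩

variable [I.Boundaryless] {E' : Type*} [NormedAddCommGroup E'] [NormedSpace ℝ E']
  {H' : Type*} [TopologicalSpace H'] {J : ModelWithCorners ℝ E' H'} [J.Boundaryless]
  {N : Type*} [TopologicalSpace N] [ChartedSpace H' N]
  {C : Type*} [NormedAddCommGroup C] [NormedSpace ℝ C]

theorem exists_charts_of_isSubmersionAtOfComplement {f : M → N} {x : M}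
    (hf : Manifold.IsSubmersionAtOfComplement C I J n f x) :
    ∃ (ψ : OpenPartialHomeomorph M (E' × C)) (χ : OpenPartialHomeomorph N E'),
      IsPartialDiffeomorph I 𝓘(ℝ, E' × C) n ψ ∧ IsPartialDiffeomorph J 𝓘(ℝ, E') n χ ∧
      x ∈ ψ.source ∧ Set.MapsTo f ψ.source χ.source ∧ ∀ y ∈ ψ.source, (ψ y).1 = χ (f y) := by
  have hφ := (isPartialDiffeomorph_of_mem_maximalAtlas hf.domChart_mem_maximalAtlas).trans
    (isPartialDiffeomorph_modelWithCorners (n := n))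
  have hχ := (isPartialDiffeomorph_of_mem_maximalAtlas hf.codChart_mem_maximalAtlas).trans
    (isPartialDiffeomorph_modelWithCorners (n := n))
  refine ⟨_, _, hφ.trans (isPartialDiffeomorph_continuousLinearEquiv hf.equiv), hχ, ?_, ?_, ?_⟩
  · simpa using hf.mem_domChart_source
  · intro y hy
    simpa using hf.source_subset_preimage_source (by simpa using hy)
  · intro y hy
    have hyφ : y ∈ hf.domChart.source := by simpa using hy
    have h := hf.writtenInCharts
      ((hf.domChart.extend I).map_source (by rwa [hf.domChart.extend_source]))
    simp only [Function.comp_apply, hf.domChart.extend_left_inv hyφ] at h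
    exact h.symm

theorem exists_contMDiffAt_section {f : M → N} {x : M}
    (hf : Manifold.IsSubmersionAtOfComplement C I J n f x) :
    ∃ s : N → M, ContMDiffAt J I n s (f x) ∧ s (f x) = x ∧ ∀ᶠ z in 𝓝 (f x), f (s z) = z := by
  obtain ⟨ψ, χ, hψ, hχ, hx, hmaps, hψχ⟩ := exists_charts_of_isSubmersionAtOfComplement hf
  have hfx := hmaps hx
  have hval : (χ (f x), (ψ x).2) = ψ x := Prod.ext (hψχ x hx).symm rfl
  have hslice : ContMDiffAt J 𝓘(ℝ, E' × C) n (fun z => (χ z, (ψ x).2)) (f x) :=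
    (hχ.contMDiffAt hfx).prodMk_space contMDiffAt_const
  have hmem : (χ (f x), (ψ x).2) ∈ ψ.target := hval ▸ ψ.map_source hx
  refine ⟨fun z => ψ.symm (χ z, (ψ x).2), (hψ.symm.contMDiffAt hmem).comp (f x) hslice,
    by simp only [hval, ψ.left_inv hx], ?_⟩
  filter_upwards [hslice.continuousAt (ψ.open_target.mem_nhds hmem),
    χ.open_source.mem_nhds hfx] with z hz hzχ
  have hs := ψ.map_target hz
  refine χ.injOn (hmaps hs) hzχ ?_
  rw [← hψχ _ hs, ψ.right_inv hz]

theorem contMDiff_of_comp_isSubmersion {E'' : Type*} [NormedAddCommGroup E''] [NormedSpace ℝ E'']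
    {H'' : Type*} [TopologicalSpace H''] {K : ModelWithCorners ℝ E'' H''}
    {P : Type*} [TopologicalSpace P] [ChartedSpace H'' P] {f : M → N}
    (hf : Manifold.IsSubmersion I J n f) (hsurj : Function.Surjective f) {g : N → P}
    (hg : ContMDiff I K n (g ∘ f)) : ContMDiff J K n g := by
  intro y
  obtain ⟨x, rfl⟩ := hsurj y
  obtain ⟨s, hs, -, hfs⟩ := exists_contMDiffAt_section
    (hf.isSubmersionAt x).isSubmersionAtOfComplement_complement
  refine ((hg (s (f x))).comp (f x) hs).congr_of_eventuallyEq ?_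
  filter_upwards [hfs] with z hz
  simp only [Function.comp_apply, hz]

end Submersions

section DifferentialForms

variable {E : Type*} [NormedAddCommGroup E] [NormedSpace ℝ E]
  {H : Type*} [TopologicalSpace H] {I : ModelWithCorners ℝ E H}
  {M : Type*} [TopologicalSpace M] [ChartedSpace H M] {n : ℕ}

/-- The expression of a form in the chart at `x`. -/
def localForm (θ : DForm I M n) (x : M) : E → E [⋀^Fin n]→L[ℝ] ℝ := fun y =>
  (θ ((extChartAt I x).symm y)).compContinuousLinearMap
    (mfderiv 𝓘(ℝ, E) I (extChartAt I x).symm y)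

/-- Differentiability of a form at `x`, expressed in the chart at `x`. -/
def DifferentiableFormAt (θ : DForm I M n) (x : M) : Prop :=
  DifferentiableAt ℝ (localForm θ x) (extChartAt I x x)

theorem dForm_eq_extDeriv_localForm [IsManifold I 1 M] (θ : DForm I M n) (x : M) :
    dForm θ x = extDeriv (localForm θ x) (extChartAt I x x) := by
  unfold dForm
  rw [mfderiv_extChartAt_self]
  rfl

theorem dForm_add [IsManifold I 1 M] {θ θ' : DForm I M n} {x : M}
    (hθ : DifferentiableFormAt θ x) (hθ' : DifferentiableFormAt θ' x) :
    dForm (θ + θ') x = dForm θ x + dForm θ' x := by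
  simp only [dForm_eq_extDeriv_localForm]
  exact extDeriv_add hθ hθ'

theorem dForm_smul [IsManifold I 1 M] (c : ℝ) (θ : DForm I M n) (x : M) :
    dForm (c • θ) x = c • dForm θ x := by
  simp only [dForm_eq_extDeriv_localForm]
  exact extDeriv_smul c (localForm θ x)

theorem DifferentiableFormAt.const_smul {θ : DForm I M n} {x : M} (hθ : DifferentiableFormAt θ x)
    (c : ℝ) : DifferentiableFormAt (c • θ) x :=
  DifferentiableAt.const_smul hθ c

theorem dForm_sub [IsManifold I 1 M] {θ θ' : DForm I M n} {x : M}
    (hθ : DifferentiableFormAt θ x) (hθ' : DifferentiableFormAt θ' x) :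
    dForm (θ - θ') x = dForm θ x - dForm θ' x := by
  rw [sub_eq_add_neg, ← neg_one_smul ℝ, dForm_add hθ (hθ'.const_smul (-1)), dForm_smul]
  exact (congrArg (dForm θ x + ·) (neg_one_smul ℝ _)).trans (sub_eq_add_neg _ _).symm

theorem DifferentiableFormAt.sum {ι : Type*} {t : Finset ι} {θ : ι → DForm I M n} {x : M}
    (hθ : ∀ i ∈ t, DifferentiableFormAt (θ i) x) : DifferentiableFormAt (∑ i ∈ t, θ i) x :=
  Finset.sum_induction θ (DifferentiableFormAt · x) (fun _ _ hθ hθ' => DifferentiableAt.add hθ hθ')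
    (differentiableAt_const 0) hθ

theorem dForm_sum [IsManifold I 1 M] {ι : Type*} {t : Finset ι} {θ : ι → DForm I M n} {x : M}
    (hθ : ∀ i ∈ t, DifferentiableFormAt (θ i) x) :
    dForm (∑ i ∈ t, θ i) x = ∑ i ∈ t, dForm (θ i) x := by
  classical
  induction t using Finset.induction_on with
  | empty => simpa using dForm_smul 0 (0 : DForm I M n) x
  | insert i t hi ih =>
    rw [Finset.forall_mem_insert] at hθ
    rw [Finset.sum_insert hi, Finset.sum_insert hi, dForm_add hθ.1 (.sum hθ.2), ih hθ.2]

theorem compContinuousLinearMap_congr {X : Type*} [NormedAddCommGroup X] [NormedSpace ℝ X]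
    (θ : DForm I M n) {a b : M} (hab : a = b) {A B : X →L[ℝ] E} (hAB : A = B) :
    (θ a : E [⋀^Fin n]→L[ℝ] ℝ).compContinuousLinearMap A =
      (θ b : E [⋀^Fin n]→L[ℝ] ℝ).compContinuousLinearMap B := by
  rw [hab, hAB]

variable {E' : Type*} [NormedAddCommGroup E'] [NormedSpace ℝ E']
  {H' : Type*} [TopologicalSpace H'] {I' : ModelWithCorners ℝ E' H'}
  {M' : Type*} [TopologicalSpace M'] [ChartedSpace H' M']

theorem writtenInExtChartAt_extChartAt_self {f : M → M'} {x : M} :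
    writtenInExtChartAt I I' x f (extChartAt I x x) = extChartAt I' (f x) (f x) := by
  simp only [writtenInExtChartAt, Function.comp_apply, extChartAt_to_inv]

variable [I.Boundaryless]

theorem contDiffAt_writtenInExtChartAt {f : M → M'} {x : M} {k : WithTop ℕ∞}
    (hf : ContMDiffAt I I' k f x) :
    ContDiffAt ℝ k (writtenInExtChartAt I I' x f) (extChartAt I x x) := by
  have h := (contMDiffAt_iff.1 hf).2
  rwa [I.range_eq_univ, contDiffWithinAt_univ] at h

variable [IsManifold I 2 M] [I'.Boundaryless] [IsManifold I' 2 M']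

theorem mdifferentiableAt_extChartAt_symm {x : M} {y : E} (hy : y ∈ (extChartAt I x).target) :
    MDifferentiableAt 𝓘(ℝ, E) I (extChartAt I x).symm y :=
  ((contMDiffOn_extChartAt_symm (n := 2) x).contMDiffAt
    ((isOpen_extChartAt_target x).mem_nhds hy)).mdifferentiableAt two_ne_zero

theorem localForm_pullbackForm {f : M → M'} {x : M} (hf : ContMDiffAt I I' 2 f x)
    (θ : DForm I' M' n) :
    localForm (pullbackForm (I := I) f θ) x =ᶠ[𝓝 (extChartAt I x x)] fun y =>
      (localForm θ (f x) (writtenInExtChartAt I I' x f y)).compContinuousLinearMap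
        (fderiv ℝ (writtenInExtChartAt I I' x f) y) := by
  have hx : (extChartAt I x).symm (extChartAt I x x) = x := extChartAt_to_inv x
  have hsymm := continuousAt_extChartAt_symm (I := I) x
  have hsource : ∀ᶠ y in 𝓝 (extChartAt I x x),
      f ((extChartAt I x).symm y) ∈ (extChartAt I' (f x)).source :=
    (ContinuousAt.comp (by rw [hx]; exact hf.continuousAt) hsymm).eventually_mem
      (by rw [Function.comp_apply, hx]; exact extChartAt_source_mem_nhds (f x))
  have hfd : ∀ᶠ y in 𝓝 (extChartAt I x x), ContMDiffAt I I' 2 f ((extChartAt I x).symm y) :=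
    hsymm.eventually (by rw [hx]; exact (contMDiffAt_iff_contMDiffAt_nhds (by simp)).1 hf)
  have hwritten := (contDiffAt_writtenInExtChartAt hf).eventually (by simp)
  filter_upwards [hsource.eventually_nhds, hfd, hwritten,
    extChartAt_target_mem_nhds (I := I) x] with y hy hfy hwy hyt
  have hchart := (mdifferentiableAt_extChartAt_symm hyt).hasMFDerivAt
  have hchart' := (mdifferentiableAt_extChartAt_symm (I := I')
    ((extChartAt I' (f x)).map_source hy.self_of_nhds)).hasMFDerivAt
  have hcomp := (hfy.mdifferentiableAt two_ne_zero).hasMFDerivAt.comp y hchart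
  have hcomp' := hchart'.comp y (hwy.differentiableAt two_ne_zero).hasFDerivAt.hasMFDerivAt
  have heq : ∀ᶠ z in 𝓝 y, f ((extChartAt I x).symm z) =
      (extChartAt I' (f x)).symm (writtenInExtChartAt I I' x f z) :=
    hy.mono fun z hz => ((extChartAt I' (f x)).left_inv hz).symm
  exact compContinuousLinearMap_congr (X := E) θ heq.self_of_nhds
    (hasMFDerivAt_unique hcomp (hcomp'.congr_of_eventuallyEq heq))

theorem dForm_pullbackForm {f : M → M'} {x : M} (hf : ContMDiffAt I I' 2 f x)
    {θ : DForm I' M' n} (hθ : DifferentiableFormAt θ (f x)) :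
    dForm (pullbackForm (I := I) f θ) x = pullbackForm f (dForm θ) x := by
  rw [dForm_eq_extDeriv_localForm, (localForm_pullbackForm hf θ).extDeriv_eq,
    extDeriv_pullback (r := 2) (by rwa [writtenInExtChartAt_extChartAt_self])
      (contDiffAt_writtenInExtChartAt hf) (by rw [minSmoothness_of_isRCLikeNormedField]),
    writtenInExtChartAt_extChartAt_self]
  unfold pullbackForm
  rw [dForm_eq_extDeriv_localForm, (hf.mdifferentiableAt two_ne_zero).mfderiv, I.range_eq_univ,
    fderivWithin_univ]
  rfl

theorem DifferentiableFormAt.pullbackForm {f : M → M'} {x : M} (hf : ContMDiffAt I I' 2 f x)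
    {θ : DForm I' M' n} (hθ : DifferentiableFormAt θ (f x)) :
    DifferentiableFormAt (pullbackForm (I := I) f θ) x := by
  refine DifferentiableAt.congr_of_eventuallyEq ?_ (localForm_pullbackForm hf θ)
  have hwritten := contDiffAt_writtenInExtChartAt hf
  have hfderiv : DifferentiableAt ℝ (fderiv ℝ (writtenInExtChartAt I I' x f))
      (extChartAt I x x) :=
    (hwritten.fderiv_right (m := 1) one_add_one_eq_two.le).differentiableAt one_ne_zero
  refine DifferentiableAt.continuousAlternatingMapCompContinuousLinearMap ?_ hfderiv
  exact DifferentiableAt.comp (g := localForm θ (f x)) _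
    (by rwa [writtenInExtChartAt_extChartAt_self]) (hwritten.differentiableAt two_ne_zero)

end DifferentialForms

section SubmanifoldsAndQuotients

variable {E : Type*} [NormedAddCommGroup E] [NormedSpace ℝ E]
  {H : Type*} [TopologicalSpace H] {I : ModelWithCorners ℝ E H}
  {M : Type*} [TopologicalSpace M] [ChartedSpace H M]

theorem SubmanifoldStructure.contMDiff_val [IsManifold I ∞ M] {L : Set M}
    (S : SubmanifoldStructure I L) : ContMDiff (𝓡 S.dim) I ∞ (Subtype.val : L → M) :=
  S.isSmoothEmbedding.isImmersion.contMDiff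

theorem SubmanifoldStructure.contMDiff_of_val [IsManifold I ∞ M] {E' : Type*}
    [NormedAddCommGroup E'] [NormedSpace ℝ E'] {H' : Type*} [TopologicalSpace H']
    {I' : ModelWithCorners ℝ E' H'} {N : Type*} [TopologicalSpace N] [ChartedSpace H' N]
    [IsManifold I' ∞ N] {L : Set M} (S : SubmanifoldStructure I L) {f : N → L}
    (hf : ContMDiff I' I ∞ fun x => (f x : M)) : ContMDiff I' (𝓡 S.dim) ∞ f :=
  (ContMDiff.iff_comp_isImmersion S.isSmoothEmbedding.isImmersion).2
    ⟨hf.continuous.subtype_mk fun x => (f x).2, hf⟩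

/-- The restriction of a diffeomorphism to embedded submanifolds which correspond under it. -/
def SubmanifoldStructure.restrictDiffeomorph [IsManifold I ∞ M] {L L' : Set M}
    (S : SubmanifoldStructure I L) (S' : SubmanifoldStructure I L') (f : Diffeomorph I I M M ∞)
    (h : ∀ x, x ∈ L ↔ f x ∈ L') : Diffeomorph (𝓡 S.dim) (𝓡 S'.dim) L L' ∞ where
  toFun x := ⟨f x, (h x).1 x.2⟩
  invFun x := ⟨f.symm x, (h _).2 (by rw [f.apply_symm_apply]; exact x.2)⟩
  left_inv x := Subtype.ext (f.symm_apply_apply x.1)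
  right_inv x := Subtype.ext (f.apply_symm_apply x.1)
  contMDiff_toFun := S'.contMDiff_of_val (f.contMDiff.comp S.contMDiff_val)
  contMDiff_invFun := S.contMDiff_of_val (f.symm.contMDiff.comp S'.contMDiff_val)

theorem exists_diffeomorph_quotient [I.Boundaryless] [IsManifold I ∞ M] {E' : Type*}
    [NormedAddCommGroup E'] [NormedSpace ℝ E'] {H' : Type*} [TopologicalSpace H']
    {I' : ModelWithCorners ℝ E' H'} [I'.Boundaryless] {M' : Type*} [TopologicalSpace M']
    [ChartedSpace H' M'] [IsManifold I' ∞ M'] (f : Diffeomorph I I' M M' ∞)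
    {s : Setoid M} {s' : Setoid M'} (hs : ∀ x y, s x y ↔ s' (f x) (f y))
    (T : QuotientManifoldStructure I s) (T' : QuotientManifoldStructure I' s') :
    ∃ g : Diffeomorph (𝓡 T.dim) (𝓡 T'.dim) (Quotient s) (Quotient s') ∞,
      ∀ x, g (Quotient.mk s x) = Quotient.mk s' (f x) := by
  have hsymm : ∀ x y, s' x y → s (f.symm x) (f.symm y) := fun x y h => by
    rwa [hs, f.apply_symm_apply, f.apply_symm_apply]
  refine ⟨⟨⟨Quotient.map f fun x y => (hs x y).1, Quotient.map f.symm hsymm, ?_, ?_⟩, ?_, ?_⟩,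
    fun _ => rfl⟩
  · rintro ⟨x⟩
    exact congrArg (Quotient.mk s) (f.symm_apply_apply x)
  · rintro ⟨x⟩
    exact congrArg (Quotient.mk s') (f.apply_symm_apply x)
  · exact contMDiff_of_comp_isSubmersion T.isSubmersion Quotient.mk_surjective
      (T'.isSubmersion.contMDiff.comp f.contMDiff)
  · exact contMDiff_of_comp_isSubmersion T'.isSubmersion Quotient.mk_surjective
      (T.isSubmersion.contMDiff.comp f.symm.contMDiff)

end SubmanifoldsAndQuotients

section ProperActions

variable {G X Y : Type*} [Group G] [TopologicalSpace G] [TopologicalSpace X] [TopologicalSpace Y]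
  [MulAction G X] [MulAction G Y]

theorem properSMul_of_continuous_equivariant [T2Space X] [T2Space Y] [ContinuousSMul G X]
    [ProperSMul G Y] {f : X → Y} (hf : Continuous f) (hsmul : ∀ (g : G) x, f (g • x) = g • f x) :
    ProperSMul G X := by
  refine properSMul_iff_continuousSMul_ultrafilter_tendsto_t2.2
    ⟨inferInstance, fun 𝒰 x₁ x₂ h => ?_⟩
  have hY := (properSMul_iff_continuousSMul_ultrafilter_tendsto_t2.1 ‹ProperSMul G Y›).2
    (𝒰.map fun p : G × X => (p.1, f p.2)) (f x₁) (f x₂)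
  simp only [Ultrafilter.coe_map, Filter.tendsto_map'_iff] at hY
  refine hY (((hf.prodMap hf).tendsto (x₁, x₂)).comp h |>.congr fun p => ?_)
  exact Prod.ext (hsmul p.1 p.2) rfl

end ProperActions

section TotalSpaces

variable {B : Type*} [TopologicalSpace B] (F : Type*) [TopologicalSpace F]
  (E : B → Type*) [TopologicalSpace (TotalSpace F E)] [∀ b, TopologicalSpace (E b)]
  [FiberBundle F E]

theorem t2Space_totalSpace [T2Space B] [T2Space F] : T2Space (TotalSpace F E) := by
  refine ⟨fun x y hxy => ?_⟩
  by_cases hb : x.proj = y.proj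
  · let e := trivializationAt F E x.proj
    have hx : x ∈ e.source := FiberBundle.mem_trivializationAt_proj_source
    have hy : y ∈ e.source := by
      rw [e.mem_source, ← hb]
      exact FiberBundle.mem_baseSet_trivializationAt' x.proj
    obtain ⟨u, v, hu, hv, hxu, hyv, huv⟩ := t2_separation (e.injOn.ne hx hy hxy)
    exact ⟨e.source ∩ e ⁻¹' u, e.source ∩ e ⁻¹' v,
      e.continuousOn.isOpen_inter_preimage e.open_source hu,
      e.continuousOn.isOpen_inter_preimage e.open_source hv, ⟨hx, hxu⟩, ⟨hy, hyv⟩,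
      (huv.preimage e).mono Set.inter_subset_right Set.inter_subset_right⟩
  · exact separated_by_continuous (FiberBundle.continuous_proj F E) hb

theorem secondCountableTopology_totalSpace [SecondCountableTopology B]
    [SecondCountableTopology F] : SecondCountableTopology (TotalSpace F E) := by
  obtain ⟨s, hs, hcover⟩ := TopologicalSpace.countable_cover_nhds
    (f := fun b : B => (trivializationAt F E b).baseSet) fun b =>
      (trivializationAt F E b).open_baseSet.mem_nhds (FiberBundle.mem_baseSet_trivializationAt' b)
  have : Countable s := hs.to_subtype
  have (b : s) : SecondCountableTopology (trivializationAt F E (b : B)).source :=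
    (trivializationAt F E (b : B)).toOpenPartialHomeomorph.secondCountableTopology_source
  refine TopologicalSpace.secondCountableTopology_of_countable_cover
    (fun b : s => (trivializationAt F E (b : B)).open_source)
    (Set.eq_univ_of_forall fun x => ?_)
  obtain ⟨b, hb, hx⟩ := Set.mem_iUnion₂.1 (hcover ▸ Set.mem_univ x.proj)
  exact Set.mem_iUnion.2 ⟨⟨b, hb⟩, (Trivialization.mem_source _).2 hx⟩

end TotalSpaces

section Frames

variable {E : Type*} [NormedAddCommGroup E] [NormedSpace ℝ E]
  {H : Type*} [TopologicalSpace H] {I : ModelWithCorners ℝ E H}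
  {M : Type*} [TopologicalSpace M] [ChartedSpace H M] {n : WithTop ℕ∞}
  {ι : Type*} {X : Type*} [NormedAddCommGroup X] [NormedSpace ℝ X]

theorem contMDiff_of_apply_single [Fintype ι] [DecidableEq ι] {m : M → (ι → ℝ) →L[ℝ] X}
    (hm : ∀ i, ContMDiff I 𝓘(ℝ, X) n fun x => m x (Pi.single i 1)) :
    ContMDiff I 𝓘(ℝ, (ι → ℝ) →L[ℝ] X) n m := by
  have hsum : m = fun x => ∑ i, ContinuousLinearMap.smulRightL ℝ (ι → ℝ) X
      (ContinuousLinearMap.proj i) (m x (Pi.single i 1)) := by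
    funext x
    ext a
    have ha := congrArg (m x) (pi_eq_sum_univ' a)
    rw [map_sum] at ha
    simpa using ha
  rw [hsum]
  exact ContMDiff.sum fun i _ => (ContinuousLinearMap.smulRightL ℝ (ι → ℝ) X
    (ContinuousLinearMap.proj i)).contDiff.contMDiff.comp (hm i)

theorem contMDiff_of_apply_basis [Finite ι] {V : Type*} [NormedAddCommGroup V] [NormedSpace ℝ V]
    {b : M → Module.Basis ι ℝ V} (hb : ∀ i, ContMDiff I 𝓘(ℝ, V) n fun x => b x i)
    {m : M → V →L[ℝ] X} (hm : ∀ i, ContMDiff I 𝓘(ℝ, X) n fun x => m x (b x i)) :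
    ContMDiff I 𝓘(ℝ, V →L[ℝ] X) n m := by
  classical
  have := Fintype.ofFinite ι
  let e (x : M) : (ι → ℝ) ≃L[ℝ] V := (b x).equivFunL.symm
  have he (x : M) (i : ι) : e x (Pi.single i 1) = b x i :=
    (b x).equivFunL.symm_apply_eq.2 (by
      ext j
      simp [Module.Basis.equivFunL, Pi.single_apply, eq_comm])
  have hframe : ContMDiff I 𝓘(ℝ, (ι → ℝ) →L[ℝ] V) n fun x => (e x : (ι → ℝ) →L[ℝ] V) :=
    contMDiff_of_apply_single fun i => by simpa [he] using hb i
  have hcoframe : ContMDiff I 𝓘(ℝ, V →L[ℝ] ι → ℝ) n fun x => ((e x).symm : V →L[ℝ] ι → ℝ) := by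
    simp only [← ContinuousLinearMap.inverse_equiv]
    exact fun x => (contDiffAt_map_inverse (e x)).contMDiffAt.comp x (hframe x)
  have hcomp : ContMDiff I 𝓘(ℝ, (ι → ℝ) →L[ℝ] X) n fun x => (m x).comp (e x : (ι → ℝ) →L[ℝ] V) :=
    contMDiff_of_apply_single fun i => by simpa [he] using hm i
  refine (hcomp.clm_comp hcoframe).congr fun x => ?_
  ext v
  simp

theorem contMDiff_of_apply_frame_eq_const [Finite ι] {V : Type*} [NormedAddCommGroup V]
    [NormedSpace ℝ V] {η : ι → M → V} (hη_smooth : ∀ i, ContMDiff I 𝓘(ℝ, V) n (η i))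
    (hη_indep : ∀ x, LinearIndependent ℝ fun i => η i x)
    (hη_span : ∀ x, Submodule.span ℝ (Set.range fun i => η i x) = ⊤)
    {m : M → V →L[ℝ] X} {c : ι → X} (hm : ∀ i x, m x (η i x) = c i) :
    ContMDiff I 𝓘(ℝ, V →L[ℝ] X) n m := by
  refine contMDiff_of_apply_basis (b := fun x => .mk (hη_indep x) (hη_span x).ge)
    (fun i => ?_) fun i => ?_
  · simpa only [Module.Basis.mk_apply] using hη_smooth i
  · simpa only [Module.Basis.mk_apply, hm] using contMDiff_const

end Frames

section CovectorBundles

variable {E : Type*} [NormedAddCommGroup E] [NormedSpace ℝ E]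
  {H : Type*} [TopologicalSpace H] (I : ModelWithCorners ℝ E H)
  (M : Type*) [TopologicalSpace M] [ChartedSpace H M] [IsManifold I ∞ M]
  {E' : Type*} [NormedAddCommGroup E'] [NormedSpace ℝ E']
  {H' : Type*} [TopologicalSpace H'] {I' : ModelWithCorners ℝ E' H'}
  {M' : Type*} [TopologicalSpace M'] [ChartedSpace H' M'] [IsManifold I' ∞ M']
  {EN : Type*} [NormedAddCommGroup EN] [NormedSpace ℝ EN]
  {HN : Type*} [TopologicalSpace HN] {J : ModelWithCorners ℝ EN HN}
  {N : Type*} [TopologicalSpace N] [ChartedSpace HN N]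
  (W : Type*) [NormedAddCommGroup W] [NormedSpace ℝ W]

/-- The bundle of `W`-valued covectors. For `W = ℝ` over a manifold modelled on its own model
vector space this is `Cotangent`, definitionally. -/
abbrev HomTangent : Type _ :=
  TotalSpace (E →L[ℝ] W) (fun x : M => TangentSpace I x →L[ℝ] Bundle.Trivial M W x)

variable {M}

/-- The inverse of the trivialization at `x` of the tangent bundle, on the fibre over `y`. -/
def tangentFrame (x y : M) : E →L[ℝ] E :=
  (trivializationAt E (TangentSpace I) x).symmL ℝ y

/-- The trivialization at `x` of the tangent bundle, on the fibre over `y`. -/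
def tangentCoframe (x y : M) : E →L[ℝ] E :=
  (trivializationAt E (TangentSpace I) x).continuousLinearMapAt ℝ y

variable {I} {W}

theorem tangentFrame_comp_tangentCoframe {x y : M}
    (hy : y ∈ (trivializationAt E (TangentSpace I) x).baseSet) :
    (tangentFrame I x y).comp (tangentCoframe I x y) = .id ℝ E :=
  ContinuousLinearMap.ext fun v : E =>
    (trivializationAt E (TangentSpace I) x).symmL_continuousLinearMapAt hy v

theorem contMDiffAt_homTangent {f : N → HomTangent I M W} {p : N} :
    ContMDiffAt J (I.prod 𝓘(ℝ, E →L[ℝ] W)) ∞ f p ↔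
      ContMDiffAt J I ∞ (fun z => (f z).1) p ∧
      ContMDiffAt J 𝓘(ℝ, E →L[ℝ] W) ∞ (fun z =>
        (show E →L[ℝ] W from (f z).2).comp (tangentFrame I (f p).1 (f z).1)) p := by
  rw [contMDiffAt_hom_bundle]
  refine and_congr_right fun _ => iff_of_eq (congrArg (ContMDiffAt J _ ∞ · p) ?_)
  funext z
  ext v
  simp only [ContinuousLinearMap.inCoordinates, Trivial.fiberBundle_trivializationAt',
    Trivial.continuousLinearMapAt_trivialization, ContinuousLinearMap.id_comp,
    ContinuousLinearMap.comp_apply, tangentFrame]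
  rfl

theorem contMDiff_homTangent_mk {x : M} {a : N → E →L[ℝ] W} :
    ContMDiff J (I.prod 𝓘(ℝ, E →L[ℝ] W)) ∞ (fun z => (⟨x, a z⟩ : HomTangent I M W)) ↔
      ContMDiff J 𝓘(ℝ, E →L[ℝ] W) ∞ a := by
  refine ⟨fun h p => ?_, fun h p => contMDiffAt_homTangent.2
    ⟨contMDiffAt_const, (h p).clm_comp (contMDiffAt_const (c := tangentFrame I x x))⟩⟩
  have hframe := (contMDiffAt_homTangent.1 (h p)).2.clm_comp
    (contMDiffAt_const (c := tangentCoframe I x x))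
  have hid := tangentFrame_comp_tangentCoframe (I := I)
    (FiberBundle.mem_baseSet_trivializationAt' (F := E) (E := TangentSpace I) x)
  refine hframe.congr_of_eventuallyEq (.of_forall fun z => ?_)
  exact ((ContinuousLinearMap.comp_assoc _ _ _).trans
    ((congrArg (a z).comp hid).trans (a z).comp_id)).symm

theorem contMDiffAt_homTangent_modelSpace {f : N → HomTangent 𝓘(ℝ, E) E W} {p : N} :
    ContMDiffAt J (𝓘(ℝ, E).prod 𝓘(ℝ, E →L[ℝ] W)) ∞ f p ↔
      ContMDiffAt J 𝓘(ℝ, E) ∞ (fun z => (f z).1) p ∧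
      ContMDiffAt J 𝓘(ℝ, E →L[ℝ] W) ∞ (fun z => (show E →L[ℝ] W from (f z).2)) p := by
  rw [contMDiffAt_homTangent]
  refine and_congr_right fun _ => iff_of_eq (congrArg (ContMDiffAt J _ ∞ · p) ?_)
  funext z
  have h : tangentFrame 𝓘(ℝ, E) (f p).1 (f z).1 = 1 := TangentBundle.symmL_model_space _ _
  rw [h]
  rfl

theorem contMDiffAt_covector_comp_mfderiv [IsManifold J 1 N] {f : N → HomTangent I M W}
    {φ : N → M' → M} {g : N → M'} {p : N} (hf : ContMDiffAt J (I.prod 𝓘(ℝ, E →L[ℝ] W)) ∞ f p)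
    (hφ : ContMDiffAt (J.prod I') I ∞ (Function.uncurry φ) (p, g p))
    (hg : ContMDiffAt J I' ∞ g p) (hφg : ∀ z, φ z (g z) = (f z).1) :
    ContMDiffAt J (I'.prod 𝓘(ℝ, E' →L[ℝ] W)) ∞
      (fun z => (⟨g z, ContinuousLinearMap.comp (show E →L[ℝ] W from (f z).2)
        (mfderiv I' I (φ z) (g z) : E' →L[ℝ] E)⟩ : HomTangent I' M' W)) p := by
  refine contMDiffAt_homTangent.2 ⟨hg, ?_⟩
  obtain ⟨hbase, hfibre⟩ := contMDiffAt_homTangent.1 hf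
  have hD := ContMDiffAt.mfderiv φ g hφ hg (m := ∞) le_rfl
  simp only [hφg] at hD
  refine (hfibre.clm_comp hD).congr_of_eventuallyEq ?_
  have hmem : ∀ᶠ z in 𝓝 p, (f z).1 ∈ (trivializationAt E (TangentSpace I) (f p).1).baseSet :=
    hbase.continuousAt.preimage_mem_nhds ((trivializationAt E _ _).open_baseSet.mem_nhds
      (FiberBundle.mem_baseSet_trivializationAt' (F := E) (E := TangentSpace I) (f p).1))
  filter_upwards [hmem] with z hz
  ext v
  exact congrArg (show E →L[ℝ] W from (f z).2)
    (DFunLike.congr_fun (tangentFrame_comp_tangentCoframe hz)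
      ((mfderiv I' I (φ z) (g z) : E' →L[ℝ] E) (tangentFrame I' (g p) (g z) v))).symm

/-- A field of `W`-valued covectors, as a section of the bundle. -/
def covectorSection (β : ∀ x : M, TangentSpace I x →L[ℝ] W) (x : M) : HomTangent I M W := ⟨x, β x⟩

theorem contMDiff_covectorSection_comp {W' : Type*} [NormedAddCommGroup W'] [NormedSpace ℝ W']
    {β : ∀ x : M, TangentSpace I x →L[ℝ] W} {m : M → W →L[ℝ] W'}
    (hβ : ContMDiff I (I.prod 𝓘(ℝ, E →L[ℝ] W)) ∞ (covectorSection β))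
    (hm : ContMDiff I 𝓘(ℝ, W →L[ℝ] W') ∞ m) :
    ContMDiff I (I.prod 𝓘(ℝ, E →L[ℝ] W')) ∞ (covectorSection fun x => (m x).comp (β x)) :=
  fun x =>
    have hβ' := contMDiffAt_homTangent.1 (hβ x)
    contMDiffAt_homTangent.2 ⟨hβ'.1, (hm x).clm_comp hβ'.2⟩

theorem differentiableFormAt_oneForm [I.Boundaryless] {θ : ∀ x : M, TangentSpace I x →L[ℝ] ℝ}
    (hθ : ContMDiff I (I.prod 𝓘(ℝ, E →L[ℝ] ℝ)) ∞ (covectorSection θ)) (x : M) :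
    DifferentiableFormAt (oneForm θ) x := by
  have hsymm : ContMDiffAt 𝓘(ℝ, E) I ∞ (extChartAt I x).symm (extChartAt I x x) :=
    (contMDiffOn_extChartAt_symm x).contMDiffAt (extChartAt_target_mem_nhds x)
  have hlocal := contMDiffAt_homTangent_modelSpace.1 (contMDiffAt_covector_comp_mfderiv
    (φ := fun _ => (extChartAt I x).symm) ((hθ _).comp _ hsymm)
    (hsymm.comp (_, _) contMDiffAt_snd) contMDiffAt_id fun _ => rfl)
  exact (ContinuousAlternatingMap.ofSubsingletonLIE (𝕜 := ℝ) (E := E) (F := ℝ)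
    (0 : Fin 1)).toContinuousLinearEquiv.differentiableAt.comp _
      (hlocal.2.contDiffAt.differentiableAt (by simp))

end CovectorBundles

section CotangentBundle

variable {E : Type*} [NormedAddCommGroup E] [NormedSpace ℝ E]
  {Q : Type*} [TopologicalSpace Q] [ChartedSpace E Q] [IsManifold 𝓘(ℝ, E) ∞ Q]

theorem contMDiff_cotangentProj :
    ContMDiff (cotangentModel E) 𝓘(ℝ, E) ∞ (cotangentProj : Cotangent E Q → Q) :=
  contMDiff_proj _

theorem contMDiff_covectorSection_liouville :
    ContMDiff (cotangentModel E) ((cotangentModel E).prod 𝓘(ℝ, E × (E →L[ℝ] ℝ) →L[ℝ] ℝ)) ∞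
      (covectorSection (liouville (E := E) (Q := Q))) := fun α =>
  contMDiffAt_covector_comp_mfderiv (φ := fun _ => cotangentProj) contMDiffAt_id
    ((contMDiff_cotangentProj α).comp (_, _) contMDiffAt_snd) contMDiffAt_id fun _ => rfl

/-- Fibrewise translation of `T^*Q` by minus a `1`-form. -/
def subCovector (β : ∀ x : Q, TangentSpace 𝓘(ℝ, E) x →L[ℝ] ℝ) (α : Cotangent E Q) :
    Cotangent E Q :=
  ⟨α.1, (show TangentSpace 𝓘(ℝ, E) α.1 →L[ℝ] ℝ from α.2) - β α.1⟩

theorem contMDiff_subCovector {β : ∀ x : Q, TangentSpace 𝓘(ℝ, E) x →L[ℝ] ℝ}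
    (hβ : ContMDiff 𝓘(ℝ, E) (𝓘(ℝ, E).prod 𝓘(ℝ, E →L[ℝ] ℝ)) ∞ (covectorSection β)) :
    ContMDiff (cotangentModel E) (cotangentModel E) ∞ (subCovector β) := fun α => by
  obtain ⟨hbase, hfibre⟩ := contMDiffAt_homTangent.1 (contMDiffAt_id (x := α))
  have hβα := (contMDiffAt_homTangent.1 (hβ α.1)).2.comp α (contMDiff_cotangentProj α)
  exact contMDiffAt_homTangent.2 ⟨hbase, (hfibre.sub hβα).congr_of_eventuallyEq
    (.of_forall fun _ => ContinuousLinearMap.sub_comp _ _ _)⟩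

/-- Translation by minus a smooth `1`-form, with inverse the translation by that `1`-form. -/
def subCovectorDiffeomorph {β : ∀ x : Q, TangentSpace 𝓘(ℝ, E) x →L[ℝ] ℝ}
    (hβ : ContMDiff 𝓘(ℝ, E) (𝓘(ℝ, E).prod 𝓘(ℝ, E →L[ℝ] ℝ)) ∞ (covectorSection β)) :
    Diffeomorph (cotangentModel E) (cotangentModel E) (Cotangent E Q) (Cotangent E Q) ∞ where
  toFun := subCovector β
  invFun := subCovector (-β)
  left_inv α := by
    refine cotangent_ext (E := E) rfl ?_
    exact (sub_neg_eq_add _ (β α.1)).trans (sub_add_cancel (show E →L[ℝ] ℝ from α.2) (β α.1))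
  right_inv α := by
    refine cotangent_ext (E := E) rfl ?_
    exact sub_eq_of_eq_add (sub_neg_eq_add (show E →L[ℝ] ℝ from α.2) (β α.1))
  contMDiff_toFun := contMDiff_subCovector hβ
  contMDiff_invFun := by
    refine contMDiff_subCovector ((contMDiff_covectorSection_comp hβ
      (contMDiff_const (c := -ContinuousLinearMap.id ℝ ℝ))).congr fun x => ?_)
    exact congrArg (TotalSpace.mk x) (ContinuousLinearMap.ext fun _ => rfl)

theorem surjective_mfderiv_of_fibre {W : Type*} [NormedAddCommGroup W] [NormedSpace ℝ W]
    {G : Cotangent E Q → W} {x : Q} {a : E →L[ℝ] ℝ}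
    (hG : MDifferentiableAt (cotangentModel E) 𝓘(ℝ, W) G ⟨x, a⟩) {T : (E →L[ℝ] ℝ) →L[ℝ] W}
    (hT : Function.Surjective T) (hGT : HasFDerivAt (fun b : E →L[ℝ] ℝ => G ⟨x, b⟩) T a) :
    Function.Surjective (mfderiv (cotangentModel E) 𝓘(ℝ, W) G ⟨x, a⟩) := by
  have hmk : ContMDiff 𝓘(ℝ, E →L[ℝ] ℝ) (cotangentModel E) ∞
      (fun b : E →L[ℝ] ℝ => (⟨x, b⟩ : Cotangent E Q)) := contMDiff_homTangent_mk.2 contMDiff_id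
  have hcomp := mfderiv_comp_of_eq hG ((hmk a).mdifferentiableAt (by simp)) rfl
  intro w
  obtain ⟨b, hb⟩ := hT w
  exact ⟨_, (DFunLike.congr_fun (hcomp.symm.trans hGT.hasMFDerivAt.mfderiv) b).trans hb⟩

end CotangentBundle

section CoadjointEquivariance

variable {Q : Type*} {V : Type*} [NormedAddCommGroup V] [NormedSpace ℝ V]
  {F : Type*} [TopologicalSpace F] [ChartedSpace V F] [Group F] [MulAction F Q]

/-- Equivariance of an `𝔣^*`-valued function on `Q` for the coadjoint action,
`⟨m(h x), ν⟩ = ⟨m(x), Ad_{h⁻¹} ν⟩`. -/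
def IsCoadjointEquivariant (m : Q → GroupLieAlgebra 𝓘(ℝ, V) F →L[ℝ] ℝ) : Prop :=
  ∀ (h : F) (x : Q), m (h • x) = (m x).comp (adjointAction h⁻¹)

theorem isCoadjointEquivariant_of_apply_frame {ι : Type*} {η : ι → Q → GroupLieAlgebra 𝓘(ℝ, V) F}
    (hη_span : ∀ x, Submodule.span ℝ (Set.range fun i => η i x) = ⊤)
    (hη : ∀ i (h : F) x, adjointAction h⁻¹ (η i (h • x)) = η i x)
    {m : Q → GroupLieAlgebra 𝓘(ℝ, V) F →L[ℝ] ℝ} {c : ι → ℝ} (hm : ∀ i x, m x (η i x) = c i) :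
    IsCoadjointEquivariant m := fun h x =>
  ContinuousLinearMap.coe_injective (LinearMap.ext_on_range (hη_span (h • x)) fun i =>
    (hm i (h • x)).trans ((hm i x).symm.trans (congrArg (m x) (hη i h x).symm)))

theorem isCoadjointEquivariant_zero :
    IsCoadjointEquivariant (0 : Q → GroupLieAlgebra 𝓘(ℝ, V) F →L[ℝ] ℝ) := fun _ _ =>
  (ContinuousLinearMap.zero_comp _).symm

end CoadjointEquivariance

section Generators

variable {E : Type*} [NormedAddCommGroup E] [NormedSpace ℝ E]
  {Q : Type*} [TopologicalSpace Q] [ChartedSpace E Q]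
  {V : Type*} [NormedAddCommGroup V] [NormedSpace ℝ V]
  {F : Type*} [TopologicalSpace F] [ChartedSpace V F] [Group F] [LieGroup 𝓘(ℝ, V) ∞ F]
  [MulAction F Q] [ContMDiffSMul 𝓘(ℝ, V) 𝓘(ℝ, E) ∞ F Q]

theorem mfderiv_smul_generator (h : F) (x : Q) (ν : GroupLieAlgebra 𝓘(ℝ, V) F) :
    mfderiv 𝓘(ℝ, E) 𝓘(ℝ, E) (fun y : Q => h • y) x (generator E V F x ν) =
      generator E V F (h • x) (adjointAction h ν) := by
  have hsmul (y : Q) : ContMDiff 𝓘(ℝ, V) 𝓘(ℝ, E) ∞ (fun g : F => g • y) :=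
    contMDiff_id.smul contMDiff_const
  have hconj : ContMDiff 𝓘(ℝ, V) 𝓘(ℝ, V) ∞ (fun g : F => h * g * h⁻¹) :=
    (contMDiff_const.mul contMDiff_id).mul contMDiff_const
  have hleft := mfderiv_comp_apply_of_eq (1 : F)
    ((ContMDiffSMul.contMDiff_const_smul (I := 𝓘(ℝ, V)) (n := ∞) h x).mdifferentiableAt (by simp))
    ((hsmul x 1).mdifferentiableAt (by simp)) (one_smul F x) ν
  have hright := mfderiv_comp_apply_of_eq (1 : F) ((hsmul (h • x) 1).mdifferentiableAt (by simp))
    ((hconj 1).mdifferentiableAt (by simp)) (by simp) ν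
  have hcomp : (fun y : Q => h • y) ∘ (fun g : F => g • x) =
      (fun g : F => g • h • x) ∘ fun g => h * g * h⁻¹ := by
    funext g
    simp [mul_smul]
  rw [hcomp] at hleft
  exact hleft.symm.trans hright

end Generators

section Momentum

variable {E : Type*} [NormedAddCommGroup E] [NormedSpace ℝ E]
  {Q : Type*} [TopologicalSpace Q] [ChartedSpace E Q] [IsManifold 𝓘(ℝ, E) ∞ Q]
  {V : Type*} [NormedAddCommGroup V] [NormedSpace ℝ V]
  {F : Type*} [TopologicalSpace F] [ChartedSpace V F] [Group F] [LieGroup 𝓘(ℝ, V) ∞ F]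
  [MulAction F Q] [ContMDiffSMul 𝓘(ℝ, V) 𝓘(ℝ, E) ∞ F Q]

theorem contMDiff_cotangentLift : ContMDiff (𝓘(ℝ, V).prod (cotangentModel E)) (cotangentModel E) ∞
    (fun p : F × Cotangent E Q => cotangentLift p.1 p.2) := fun p => by
  have hg : ContMDiff (𝓘(ℝ, V).prod (cotangentModel E)) 𝓘(ℝ, E) ∞
      (fun p : F × Cotangent E Q => p.1 • p.2.1) :=
    contMDiff_fst.smul (contMDiff_cotangentProj.comp contMDiff_snd)
  have hφ : ContMDiff ((𝓘(ℝ, V).prod (cotangentModel E)).prod 𝓘(ℝ, E)) 𝓘(ℝ, E) ∞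
      (Function.uncurry fun (p : F × Cotangent E Q) (y : Q) => p.1⁻¹ • y) :=
    ((contMDiff_inv 𝓘(ℝ, V) ∞).comp (contMDiff_fst.comp contMDiff_fst)).smul contMDiff_snd
  exact contMDiffAt_covector_comp_mfderiv (φ := fun p y => p.1⁻¹ • y) contMDiffAt_snd (hφ _) (hg p)
    fun p => inv_smul_smul p.1 p.2.1

theorem momentumMap_eq (α : Cotangent E Q) : momentumMap V F α =
    ContinuousLinearMap.comp (show TangentSpace 𝓘(ℝ, E) α.1 →L[ℝ] ℝ from α.2)
      (generator E V F α.1) := by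
  have hlift : ContMDiff 𝓘(ℝ, V) (cotangentModel E) ∞ (fun g : F => cotangentLift g α) :=
    contMDiff_cotangentLift.comp (contMDiff_id.prodMk contMDiff_const)
  ext ν
  have hgen := mfderiv_comp_apply_of_eq (1 : F)
    ((contMDiff_cotangentProj α).mdifferentiableAt (by simp))
    ((hlift 1).mdifferentiableAt (by simp)) (cotangentLift_one α) ν
  exact congrArg (show E →L[ℝ] ℝ from α.2) hgen.symm

theorem contMDiff_momentumMap : ContMDiff (cotangentModel E) 𝓘(ℝ, V →L[ℝ] ℝ) ∞
    (M' := V →L[ℝ] ℝ) (momentumMap V F : Cotangent E Q → _) := by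
  refine (contMDiff_homTangent_mk (I := 𝓘(ℝ, V)) (x := (1 : F))).1 fun α => ?_
  have hφ : ContMDiff ((cotangentModel E).prod 𝓘(ℝ, V)) 𝓘(ℝ, E) ∞
      (Function.uncurry fun (α : Cotangent E Q) (g : F) => g • α.1) :=
    contMDiff_snd.smul (contMDiff_cotangentProj.comp contMDiff_fst)
  refine (contMDiffAt_covector_comp_mfderiv contMDiffAt_id (hφ _) contMDiffAt_const
    fun α => one_smul F α.1).congr_of_eventuallyEq (.of_forall fun α => ?_)
  exact congrArg (TotalSpace.mk (1 : F)) (momentumMap_eq α)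

theorem momentumMap_cotangentLift (h : F) (α : Cotangent E Q) :
    momentumMap V F (cotangentLift h α) = (momentumMap V F α).comp (adjointAction h⁻¹) := by
  ext ν
  have hgen := mfderiv_smul_generator (E := E) h⁻¹ (h • α.1) ν
  rw [inv_smul_smul] at hgen
  rw [momentumMap_eq, momentumMap_eq]
  exact congrArg (show E →L[ℝ] ℝ from α.2) hgen

theorem cotangentLift_mem_momentumLevel {m : Q → GroupLieAlgebra 𝓘(ℝ, V) F →L[ℝ] ℝ}
    (hm : IsCoadjointEquivariant m) (h : F) (α : Cotangent E Q) (hα : α ∈ momentumLevel m) :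
    cotangentLift h α ∈ momentumLevel m :=
  (momentumMap_cotangentLift h α).trans
    ((congrArg (fun a => a.comp (adjointAction h⁻¹)) hα).trans (hm h α.1).symm)

theorem adjointAction_of_gaugeMomentum_cotangentLift {η : Q → GroupLieAlgebra 𝓘(ℝ, V) F}
    (hgen : ∀ x : Q, Function.Injective (generator E V F x))
    (hη : ∀ (h : F) (α : Cotangent E Q), gaugeMomentum η (cotangentLift h α) = gaugeMomentum η α)
    (h : F) (x : Q) : adjointAction h⁻¹ (η (h • x)) = η x := by
  refine hgen x ((SeparatingDual.eq_iff_forall_dual_eq (R := ℝ) (V := E)).2 fun a => ?_)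
  have hηa := hη h ⟨x, a⟩
  rw [gaugeMomentum, gaugeMomentum, momentumMap_cotangentLift, momentumMap_eq] at hηa
  exact hηa

theorem nonempty_submanifoldStructure_momentumLevel [FiniteDimensional ℝ E] [FiniteDimensional ℝ V]
    (hgen : ∀ x : Q, Function.Injective (generator E V F x))
    {m : Q → GroupLieAlgebra 𝓘(ℝ, V) F →L[ℝ] ℝ}
    (hm : ContMDiff 𝓘(ℝ, E) 𝓘(ℝ, V →L[ℝ] ℝ) ∞ (M' := V →L[ℝ] ℝ) m) :
    Nonempty (SubmanifoldStructure (cotangentModel E) (momentumLevel (E := E) m)) := by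
  let G (α : Cotangent E Q) : V →L[ℝ] ℝ := (momentumMap V F α : V →L[ℝ] ℝ) - m α.1
  have hG : ContMDiff (cotangentModel E) 𝓘(ℝ, V →L[ℝ] ℝ) ∞ G :=
    contMDiff_momentumMap.sub (hm.comp contMDiff_cotangentProj)
  have hlevel : momentumLevel m = {α | G α = 0} := by
    ext α
    exact sub_eq_zero.symm
  rw [hlevel]
  refine nonempty_submanifoldStructure_of_regular hG ?_
  rintro ⟨x, a⟩ -
  let g : V →L[ℝ] E := generator E V F x
  obtain ⟨P, hP⟩ := ContinuousLinearMap.HasLeftInverse.of_injective_of_finiteDimensional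
    (f := g) (hgen x)
  refine surjective_mfderiv_of_fibre (T := g.precomp ℝ) ((hG _).mdifferentiableAt (by simp))
    (fun b => ⟨b.comp P, ?_⟩) ?_
  · ext ν
    exact congrArg b (hP ν)
  · let ν : V →L[ℝ] ℝ := m x
    exact ((g.precomp ℝ).hasFDerivAt.sub_const ν).congr_of_eventuallyEq (.of_forall
      fun b => congrArg (· - ν) (momentumMap_eq ⟨x, b⟩))

end Momentum

section Shift

variable {E : Type*} [NormedAddCommGroup E] [NormedSpace ℝ E]
  {Q : Type*} [TopologicalSpace Q] [ChartedSpace E Q]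
  {V : Type*} [NormedAddCommGroup V] [NormedSpace ℝ V]
  {F : Type*} [TopologicalSpace F] [ChartedSpace V F] [Group F] [MulAction F Q]

/-- The `1`-form `⟨m, A⟩` on `Q`. -/
def PrincipalConnection.pairing [IsManifold 𝓘(ℝ, E) ∞ Q] (A : PrincipalConnection E Q V F)
    (m : Q → GroupLieAlgebra 𝓘(ℝ, V) F →L[ℝ] ℝ) (x : Q) : TangentSpace 𝓘(ℝ, E) x →L[ℝ] ℝ :=
  (m x).comp (A.form x)

variable [IsManifold 𝓘(ℝ, E) ∞ Q] (A : PrincipalConnection E Q V F)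
  {m : Q → GroupLieAlgebra 𝓘(ℝ, V) F →L[ℝ] ℝ}

theorem PrincipalConnection.injective_generator (A : PrincipalConnection E Q V F) (x : Q) :
    Function.Injective (generator E V F x) :=
  Function.LeftInverse.injective (A.form_generator x)

theorem PrincipalConnection.eq_pairing {x : Q} {y : TangentSpace 𝓘(ℝ, E) x →L[ℝ] ℝ}
    (hy : ∀ v, A.form x v = 0 → y v = 0) {ι : Type*} {ν : ι → GroupLieAlgebra 𝓘(ℝ, V) F}
    (hν : Submodule.span ℝ (Set.range ν) = ⊤) (hm : ∀ i, y (generator E V F x (ν i)) = m x (ν i)) :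
    y = A.pairing m x := by
  have hvert : y.comp (generator E V F x) = m x :=
    ContinuousLinearMap.coe_injective (LinearMap.ext_on_range hν hm)
  ext v
  have hhor : A.form x (v - generator E V F x (A.form x v)) = 0 := by
    rw [map_sub, A.form_generator, sub_self]
  have hyv := hy _ hhor
  rw [map_sub, sub_eq_zero] at hyv
  exact hyv.trans (DFunLike.congr_fun hvert (A.form x v))

theorem PrincipalConnection.contMDiff_pairing
    (hm : ContMDiff 𝓘(ℝ, E) 𝓘(ℝ, V →L[ℝ] ℝ) ∞ (M' := V →L[ℝ] ℝ) m) :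
    ContMDiff 𝓘(ℝ, E) (𝓘(ℝ, E).prod 𝓘(ℝ, E →L[ℝ] ℝ)) ∞ (covectorSection (A.pairing m)) :=
  contMDiff_covectorSection_comp (W := V) A.smooth hm

/-- The shift by a smooth `𝔣^*`-valued function, as a diffeomorphism. -/
def shiftDiffeomorph (hm : ContMDiff 𝓘(ℝ, E) 𝓘(ℝ, V →L[ℝ] ℝ) ∞ (M' := V →L[ℝ] ℝ) m) :
    Diffeomorph (cotangentModel E) (cotangentModel E) (Cotangent E Q) (Cotangent E Q) ∞ :=
  subCovectorDiffeomorph (A.contMDiff_pairing hm)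

theorem cotangentLift_shiftMap (hm : IsCoadjointEquivariant m) (h : F) (α : Cotangent E Q) :
    shiftMap A m (cotangentLift h α) = cotangentLift h (shiftMap A m α) := by
  obtain ⟨x, a⟩ := α
  refine cotangent_ext (E := E) rfl ?_
  let D : E →L[ℝ] E := mfderiv 𝓘(ℝ, E) 𝓘(ℝ, E) (fun y : Q => h⁻¹ • y) (h • x)
  ext v
  have hA := A.equivariant h⁻¹ (h • x) v
  rw [inv_smul_smul] at hA
  have hmA : m (h • x) (A.form (h • x) v) = m x (A.form x (D v)) :=
    (DFunLike.congr_fun (hm h x) _).trans (congrArg (m x) hA.symm)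
  exact congrArg (a (D v) - ·) hmA

variable [LieGroup 𝓘(ℝ, V) ∞ F] [ContMDiffSMul 𝓘(ℝ, V) 𝓘(ℝ, E) ∞ F Q]

theorem momentumMap_shiftMap (α : Cotangent E Q) :
    momentumMap V F (shiftMap A m α) = momentumMap V F α - m α.1 := by
  ext ν
  rw [momentumMap_eq, momentumMap_eq]
  exact congrArg (fun ν' => (show E →L[ℝ] ℝ from α.2) (generator E V F α.1 ν) - m α.1 ν')
    (A.form_generator α.1 ν)

theorem shiftMap_mem_momentumLevel_zero {α : Cotangent E Q} :
    shiftMap A m α ∈ momentumLevel (V := V) (F := F) 0 ↔ α ∈ momentumLevel m := by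
  change momentumMap V F (shiftMap A m α) = 0 ↔ momentumMap V F α = m α.1
  rw [momentumMap_shiftMap, sub_eq_zero]

end Shift

section Reduction

variable {E : Type*} [NormedAddCommGroup E] [NormedSpace ℝ E]
  {Q : Type*} [TopologicalSpace Q] [ChartedSpace E Q]
  (V : Type*) [NormedAddCommGroup V] [NormedSpace ℝ V]
  {F : Type*} [TopologicalSpace F] [ChartedSpace V F] [Group F]
  [MulAction F Q] [ContMDiffSMul 𝓘(ℝ, V) 𝓘(ℝ, E) ∞ F Q]

/-- The lifted action on an invariant subset of the cotangent bundle. -/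
abbrev invariantAction {L : Set (Cotangent E Q)}
    (hinv : ∀ h : F, ∀ α ∈ L, cotangentLift h α ∈ L) : MulAction F L where
  smul h α := ⟨cotangentLift h α.1, hinv h α.1 α.2⟩
  one_smul α := Subtype.ext (cotangentLift_one α.1)
  mul_smul g h α := Subtype.ext (cotangentLift_mul V g h α.1)

variable {L : Set (Cotangent E Q)}

theorem orbitSetoid_eq_orbitRel (hinv : ∀ h : F, ∀ α ∈ L, cotangentLift h α ∈ L) :
    letI := invariantAction V hinv
    orbitSetoid V F L = MulAction.orbitRel F L := by
  let _ := invariantAction V hinv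
  refine Setoid.ext fun α β => ⟨?_, ?_⟩
  · rintro ⟨h, hh⟩
    exact (MulAction.orbitRel F L).symm ⟨h, Subtype.ext hh⟩
  · rintro ⟨h, hh⟩
    exact (orbitSetoid V F L).symm ⟨h, congrArg Subtype.val hh⟩

variable {V} in
theorem orbitSetoid_iff_of_equivariant {L' : Set (Cotangent E Q)}
    {f : Cotangent E Q → Cotangent E Q} (hf : Function.Injective f)
    (hequi : ∀ (h : F) α, f (cotangentLift h α) = cotangentLift h (f α)) {α β : L} {α' β' : L'}
    (hα : α'.1 = f α) (hβ : β'.1 = f β) :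
    orbitSetoid V F L α β ↔ orbitSetoid V F L' α' β' := exists_congr fun h => by
  rw [hα, hβ, ← hequi, hf.eq_iff]

variable {V} [IsManifold 𝓘(ℝ, E) ∞ Q] [LieGroup 𝓘(ℝ, V) ∞ F]

theorem contMDiffSMul_invariantAction (hinv : ∀ h : F, ∀ α ∈ L, cotangentLift h α ∈ L)
    (S : SubmanifoldStructure (cotangentModel E) L) :
    letI := invariantAction V hinv
    ContMDiffSMul 𝓘(ℝ, V) (𝓡 S.dim) ∞ F L :=
  letI := invariantAction V hinv
  ⟨S.contMDiff_of_val (contMDiff_cotangentLift.comp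
    (contMDiff_fst.prodMk (S.contMDiff_val.comp contMDiff_snd)))⟩

theorem nonempty_quotientManifoldStructure_orbitSetoid [FiniteDimensional ℝ E]
    [FiniteDimensional ℝ V] [T2Space Q] [SecondCountableTopology Q] [ProperSMul F Q]
    (hfree : ∀ (h : F) (x : Q), h • x = x → h = 1)
    (hgen : ∀ x : Q, Function.Injective (generator E V F x))
    (hinv : ∀ h : F, ∀ α ∈ L, cotangentLift h α ∈ L)
    (S : SubmanifoldStructure (cotangentModel E) L) :
    Nonempty (QuotientManifoldStructure (𝓡 S.dim) (orbitSetoid V F L)) := by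
  let _ := invariantAction V hinv
  have hsmul := contMDiffSMul_invariantAction (V := V) hinv S
  have : T2Space (Cotangent E Q) := t2Space_totalSpace (E →L[ℝ] ℝ) _
  have : SecondCountableTopology (Cotangent E Q) :=
    secondCountableTopology_totalSpace (E →L[ℝ] ℝ) _
  have hbase : ContMDiff (𝓡 S.dim) 𝓘(ℝ, E) ∞ (fun α : L => α.1.1) :=
    contMDiff_cotangentProj.comp S.contMDiff_val
  have : ContinuousSMul F L := ⟨hsmul.contMDiff_smul.continuous⟩
  have : ProperSMul F L := properSMul_of_continuous_equivariant hbase.continuous fun _ _ => rfl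
  rw [orbitSetoid_eq_orbitRel V hinv]
  refine nonempty_quotientManifoldStructure_orbitRel (K := 𝓘(ℝ, V)) (fun h α hα => ?_) fun α => ?_
  · exact hfree h α.1.1 (congrArg (fun β : L => β.1.1) hα)
  · have horbit : ContMDiff 𝓘(ℝ, V) (𝓡 S.dim) ∞ (fun g : F => g • α) :=
      contMDiff_id.smul contMDiff_const
    have hcomp (ν) := mfderiv_comp_apply_of_eq (1 : F) ((hbase α).mdifferentiableAt (by simp))
      ((horbit 1).mdifferentiableAt (by simp)) (one_smul F α) ν
    exact fun ν ν' h => hgen α.1.1 ((hcomp ν).trans ((congrArg _ h).trans (hcomp ν').symm))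

end Reduction

section ShiftForms

variable {E : Type*} [NormedAddCommGroup E] [NormedSpace ℝ E]
  {Q : Type*} [TopologicalSpace Q] [ChartedSpace E Q] [IsManifold 𝓘(ℝ, E) ∞ Q]
  {β : ∀ x : Q, TangentSpace 𝓘(ℝ, E) x →L[ℝ] ℝ}

theorem pullbackForm_subCovector_liouville
    (hβ : ContMDiff 𝓘(ℝ, E) (𝓘(ℝ, E).prod 𝓘(ℝ, E →L[ℝ] ℝ)) ∞ (covectorSection β)) :
    pullbackForm (I := cotangentModel E) (subCovector β) (oneForm liouville) =
      oneForm liouville - pullbackForm cotangentProj (oneForm β) := by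
  funext α
  ext v
  have hbase := mfderiv_comp_apply (I'' := 𝓘(ℝ, E)) α
    ((contMDiff_cotangentProj (subCovector β α)).mdifferentiableAt (by simp))
    ((contMDiff_subCovector hβ α).mdifferentiableAt (by simp)) (v 0)
  exact congrArg (show E →L[ℝ] ℝ from (subCovector β α).2) hbase.symm

theorem pullbackForm_subCovector_canonicalForm
    (hβ : ContMDiff 𝓘(ℝ, E) (𝓘(ℝ, E).prod 𝓘(ℝ, E →L[ℝ] ℝ)) ∞ (covectorSection β)) :
    pullbackForm (subCovector β) (canonicalForm E Q) =
      canonicalForm E Q + pullbackForm cotangentProj (dForm (oneForm β)) := by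
  funext α
  have hΘ (γ : Cotangent E Q) : DifferentiableFormAt (oneForm liouville) γ :=
    differentiableFormAt_oneForm contMDiff_covectorSection_liouville γ
  have hproj : ContMDiffAt (cotangentModel E) 𝓘(ℝ, E) 2 (cotangentProj : Cotangent E Q → Q) α :=
    (contMDiff_cotangentProj α).of_le ENat.LEInfty.out
  have hβα := differentiableFormAt_oneForm hβ (cotangentProj α)
  have hd := dForm_pullbackForm ((contMDiff_subCovector hβ α).of_le ENat.LEInfty.out) (hΘ _)
  rw [pullbackForm_subCovector_liouville hβ, dForm_sub (hΘ α) (hβα.pullbackForm hproj),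
    dForm_pullbackForm hproj hβα] at hd
  exact (congrArg Neg.neg hd.symm).trans (neg_sub _ _ |>.trans (sub_eq_neg_add _ _))

end ShiftForms

theorem dForm_oneForm_sum_smul {E : Type*} [NormedAddCommGroup E] [NormedSpace ℝ E]
    {H : Type*} [TopologicalSpace H] {I : ModelWithCorners ℝ E H} [I.Boundaryless]
    {M : Type*} [TopologicalSpace M] [ChartedSpace H M] [IsManifold I ∞ M]
    {ι : Type*} {t : Finset ι} {θ : ι → ∀ x : M, TangentSpace I x →L[ℝ] ℝ}
    (hθ : ∀ i, ContMDiff I (I.prod 𝓘(ℝ, E →L[ℝ] ℝ)) ∞ (covectorSection (θ i))) (c : ι → ℝ) :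
    dForm (oneForm fun x => ∑ i ∈ t, c i • θ i x) = ∑ i ∈ t, c i • dForm (oneForm (θ i)) := by
  have hsum : oneForm (fun x => ∑ i ∈ t, c i • θ i x) = ∑ i ∈ t, c i • oneForm (θ i) := by
    funext x
    ext v
    simp [oneForm]
  funext x
  rw [hsum, dForm_sum fun i _ => (differentiableFormAt_oneForm (hθ i) x).const_smul (c i),
    Finset.sum_apply]
  exact Finset.sum_congr rfl fun i _ => dForm_smul (c i) _ x

section ShiftPullback

variable {E : Type*} [NormedAddCommGroup E] [NormedSpace ℝ E]
  {Q : Type*} [TopologicalSpace Q] [ChartedSpace E Q] [IsManifold 𝓘(ℝ, E) ∞ Q]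
  {V : Type*} [NormedAddCommGroup V] [NormedSpace ℝ V]
  {F : Type*} [TopologicalSpace F] [ChartedSpace V F] [Group F] [MulAction F Q]
  (A : PrincipalConnection E Q V F) {m : Q → GroupLieAlgebra 𝓘(ℝ, V) F →L[ℝ] ℝ}

theorem PrincipalConnection.dForm_oneForm_pairing {ι : Type*} {t : Finset ι}
    {μ : ι → Q → GroupLieAlgebra 𝓘(ℝ, V) F →L[ℝ] ℝ}
    (hμ : ∀ i, ContMDiff 𝓘(ℝ, E) 𝓘(ℝ, V →L[ℝ] ℝ) ∞ (M' := V →L[ℝ] ℝ) (μ i)) {c : ι → ℝ}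
    (hm : ∀ x, m x = ∑ i ∈ t, c i • μ i x) :
    dForm (oneForm (A.pairing m)) = ∑ i ∈ t, c i • dForm (oneForm (A.pairing (μ i))) := by
  rw [← dForm_oneForm_sum_smul (fun i => A.contMDiff_pairing (hμ i))]
  congr 2
  funext x
  ext v
  simp [PrincipalConnection.pairing, hm]

theorem pullbackForm_shiftMap_canonicalForm
    (hm : ContMDiff 𝓘(ℝ, E) 𝓘(ℝ, V →L[ℝ] ℝ) ∞ (M' := V →L[ℝ] ℝ) m) :
    pullbackForm (shiftMap A m) (canonicalForm E Q) =
      canonicalForm E Q + pullbackForm cotangentProj (dForm (oneForm (A.pairing m))) :=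
  pullbackForm_subCovector_canonicalForm (β := A.pairing m) (A.contMDiff_pairing hm)

end ShiftPullback

end

theorem lemma4p2
    {E : Type*} [NormedAddCommGroup E] [NormedSpace ℝ E] [FiniteDimensional ℝ E]
    {Q : Type*} [TopologicalSpace Q] [T2Space Q] [SecondCountableTopology Q]
    [ChartedSpace E Q] [IsManifold 𝓘(ℝ, E) ∞ Q]
    {V : Type*} [NormedAddCommGroup V] [NormedSpace ℝ V] [FiniteDimensional ℝ V]
    {F : Type*} [TopologicalSpace F] [ChartedSpace V F] [Group F] [LieGroup 𝓘(ℝ, V) ∞ F]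
    [MulAction F Q] [ContMDiffSMul 𝓘(ℝ, V) 𝓘(ℝ, E) ∞ F Q] [ProperSMul F Q]
    (hfree : ∀ (h : F) (x : Q), h • x = x → h = 1)
    (A : PrincipalConnection E Q V F)
    {k : ℕ} (η : Fin k → Q → GroupLieAlgebra 𝓘(ℝ, V) F)
    (hη_smooth : ∀ i, ContMDiff 𝓘(ℝ, E) 𝓘(ℝ, V) ∞ (M' := V) (η i))
    (hη_indep : ∀ x, LinearIndependent ℝ (fun i => η i x))
    (hη_span : ∀ x, Submodule.span ℝ (Set.range fun i => η i x) = ⊤)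
    (hη_inv : ∀ (i : Fin k) (h : F) (α : Cotangent E Q),
      gaugeMomentum (η i) (cotangentLift h α) = gaugeMomentum (η i) α)
    (μ : Fin k → Q → GroupLieAlgebra 𝓘(ℝ, V) F →L[ℝ] ℝ)
    (hμ : ∀ i j x, μ i x (η j x) = if i = j then 1 else 0)
    (Y : Fin k → ∀ x : Q, TangentSpace 𝓘(ℝ, E) x →L[ℝ] ℝ)
    (hY_vert : ∀ i j x, Y i x (generator E V F x (η j x)) = if i = j then 1 else 0)
    (hY_hor : ∀ i x v, A.form x v = 0 → Y i x v = 0)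
    (c : Fin k → ℝ) (m : Q → GroupLieAlgebra 𝓘(ℝ, V) F →L[ℝ] ℝ)
    (hm : ∀ x, m x = ∑ i, c i • μ i x)
    (L L₀ : Set (Cotangent E Q)) (hL : L = momentumLevel m) (hL₀ : L₀ = momentumLevel (V := V) (F := F) 0) :
    -- the shift is a diffeomorphism of the cotangent bundle
    (∃ Φ : Diffeomorph (cotangentModel E) (cotangentModel E) (Cotangent E Q) (Cotangent E Q) ∞,
      ∀ α, Φ α = shiftMap A m α) ∧
    -- (i) the pull-back of the canonical form
    pullbackForm (shiftMap A m) (canonicalForm E Q) =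
      canonicalForm E Q + pullbackForm cotangentProj (∑ i, c i • dForm (oneForm (Y i))) ∧
    -- (ii) the level sets are invariant, they are submanifolds, and their quotients are manifolds
    (∀ (h : F), ∀ α ∈ L, cotangentLift h α ∈ L) ∧
    (∀ (h : F), ∀ α ∈ L₀, cotangentLift h α ∈ L₀) ∧
    Nonempty (SubmanifoldStructure (cotangentModel E) L) ∧
    Nonempty (SubmanifoldStructure (cotangentModel E) L₀) ∧
    ∀ (S : SubmanifoldStructure (cotangentModel E) L)
      (S₀ : SubmanifoldStructure (cotangentModel E) L₀),
      Nonempty (QuotientManifoldStructure (𝓡 S.dim) (orbitSetoid V F L)) ∧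
      Nonempty (QuotientManifoldStructure (𝓡 S₀.dim) (orbitSetoid V F L₀)) ∧
      -- the shift restricts to an equivariant diffeomorphism of the level sets
      ∃ shift : Diffeomorph (𝓡 S.dim) (𝓡 S₀.dim) L L₀ ∞,
        (∀ α : L, (shift α : Cotangent E Q) = shiftMap A m α) ∧
        (∀ (h : F) (α : L) (hα : cotangentLift h (α : Cotangent E Q) ∈ L),
          (shift ⟨cotangentLift h α, hα⟩ : Cotangent E Q) = cotangentLift h (shift α)) ∧
        -- and descends to a diffeomorphism of the quotients
        ∀ (T : QuotientManifoldStructure (𝓡 S.dim) (orbitSetoid V F L))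
          (T₀ : QuotientManifoldStructure (𝓡 S₀.dim) (orbitSetoid V F L₀)),
          ∃ shiftBar : Diffeomorph (𝓡 T.dim) (𝓡 T₀.dim)
              (Quotient (orbitSetoid V F L)) (Quotient (orbitSetoid V F L₀)) ∞,
            ∀ α : L, shiftBar (Quotient.mk (orbitSetoid V F L) α) =
              Quotient.mk (orbitSetoid V F L₀) (shift α) := by
  subst hL hL₀
  have hY (i : Fin k) : Y i = A.pairing (μ i) := funext fun x =>
    A.eq_pairing (hY_hor i x) (hη_span x) fun j => (hY_vert i j x).trans (hμ i j x).symm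
  have hmη (i : Fin k) (x : Q) : m x (η i x) = c i := by simp [hm, hμ]
  have hμ_smooth (i : Fin k) :=
    contMDiff_of_apply_frame_eq_const (V := V) hη_smooth hη_indep hη_span (hμ i)
  have hm_smooth := contMDiff_of_apply_frame_eq_const (V := V) hη_smooth hη_indep hη_span hmη
  have hm_equi : IsCoadjointEquivariant m := isCoadjointEquivariant_of_apply_frame hη_span
    (fun i => adjointAction_of_gaugeMomentum_cotangentLift A.injective_generator (hη_inv i)) hmη
  have hd : dForm (oneForm (A.pairing m)) = ∑ i, c i • dForm (oneForm (Y i)) :=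
    (A.dForm_oneForm_pairing hμ_smooth hm).trans (Finset.sum_congr rfl fun i _ => by rw [hY])
  have hinv := cotangentLift_mem_momentumLevel (E := E) hm_equi
  have hinv₀ := cotangentLift_mem_momentumLevel (E := E) (F := F) (V := V) (Q := Q)
    isCoadjointEquivariant_zero
  let Φ := shiftDiffeomorph A hm_smooth
  exact ⟨⟨Φ, fun _ => rfl⟩, (pullbackForm_shiftMap_canonicalForm A hm_smooth).trans
      (congrArg (canonicalForm E Q + pullbackForm cotangentProj ·) hd), hinv, hinv₀,
    nonempty_submanifoldStructure_momentumLevel A.injective_generator hm_smooth,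
    nonempty_submanifoldStructure_momentumLevel A.injective_generator contMDiff_const, fun S S₀ =>
    ⟨nonempty_quotientManifoldStructure_orbitSetoid hfree A.injective_generator hinv S,
      nonempty_quotientManifoldStructure_orbitSetoid hfree A.injective_generator hinv₀ S₀,
      S.restrictDiffeomorph S₀ Φ fun _ => (shiftMap_mem_momentumLevel_zero A).symm, fun _ => rfl,
      fun h α _ => cotangentLift_shiftMap A hm_equi h α, exists_diffeomorph_quotient _ fun _ _ =>
        orbitSetoid_iff_of_equivariant Φ.injective (cotangentLift_shiftMap A hm_equi) rfl rfl⟩⟩
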